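/- Let $\mathfrak{su}(2)$ be the Lie algebra of traceless skew-Hermitian $2\times 2$ matrices with the invariant inner product $\langle x,y\rangle=-\tfrac12\,\mathrm{Killing}(x,y)=-2\,\mathrm{tr}(xy)$, normalized so that the Lie bracket is the cross product of $\mathbb{R}^3$. For $a=(a_1,a_2,a_3)\in\mathfrak{su}(2)^3$ put $\Phi(a)=\langle a_1,[a_2,a_3]\rangle$, and for $x\in\mathfrak{su}(2)$ put $l^j_x(a)=\langle x,a_j\rangle$. Where $\Phi\neq 0$, let $\pi_1$ be the bivector field with $$\{l^1_x,l^1_y\}=l^1_{[x,y]},\quad \{l^1_x,l^2_y\}=\{l^2_x,l^1_y\}=l^2_{[x,y]},\quad \{l^2_x,l^2_y\}=-l^1_{[x,y]},$$ $$\{l^1_x,l^3_y\}=\{l^3_x,l^1_y\}=l^3_{[x,y]},\quad \{l^3_x,l^3_y\}=-l^1_{[x,y]},\quad \{l^2_x,l^3_y\}=-\{l^3_x,l^2_y\}=A_{x,y},$$ where $A=\Phi^{-1}\big([a_1,a_2]^{\otimes 2}+[a_2,a_3]^{\otimes 2}+[a_3,a_1]^{\otimes 2}\big)$ and $A_{x,y}$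 is its contraction with $x$ and $y$. Let $\pi_2=\sigma_*\pi_1$ and $\pi_3=\sigma_*\pi_2$ with $\sigma(a_1,a_2,a_3)=(a_3,a_1,a_2)$. These are Poisson structures with the same symplectic leaves. Among the leaves are, for $q,r\ge 0$, the four-dimensional submanifolds $$N_{q,r}=\{a:\ \Phi(a)<0,\ \langle a_i,a_j\rangle=0\ (i\ne j),\ \langle a_1,a_1\rangle-\langle a_2,a_2\rangle=q,\ \langle a_2,a_2\rangle-\langle a_3,a_3\rangle=r\}.$$ Let $\omega_1,\omega_2,\omega_3$ be the symplectic forms induced on $N_{q,r}$ by $\pi_1,\pi_2,\pi_3$, with $\omega_i^\flat=(\pi_i^\sharp)^{-1}$, where $\pi_i^\sharp(df)=\{f,\cdot\}_i$. Let $g_{q,r}$ be the induced hyperkähler metric, $g_{q,r}^\flat=\omega_3^\flat(\omega_1^\flat)^{-1}\omega_2^\flat$, and let $\kappa_{q,r}:Gr_2(TN_{q,r})\to\mathbb{R}$ be the sectional curvature of the Levi-Civita connection of $g_{q,r}$. Then, for all real $q,r\ge 0$: 1. On $N_{0,0}$, the sectional curvature $\kappa_{0,0}$ vanishes identically. 2.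 On $N_{q,0}$ with $q>0$, $\kappa_{q,0}$ is not constant, and $|\kappa_{q,0}|\le \frac{12}{\sqrt q}$. 3. On $N_{q,r}$ with $r>0$, $\kappa_{q,r}$ is unbounded. -/

import Mathlib

open scoped ContDiff

noncomputable section

/-! ## Levi-Civita connection and sectional curvature of a submanifold of a normed space

For an embedded submanifold `N` of a finite-dimensional real vector space `E`, the tangent space of
`N` at `p` is `tangentConeAt ℝ N p`.  Tensor fields on `N` are functions on `E` of which only the
values on `N` are used, and derivatives along `N` are `fderivWithin ℝ · N p`, which are only ever
applied to vectors tangent to `N` (where they do not depend on any choice). -/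

namespace SubmanifoldGeometry

variable {E : Type*} [NormedAddCommGroup E] [NormedSpace ℝ E]

/-- `f` is smooth as a function on `N`: near each point of `N` it agrees on `N` with a smooth
function defined on an open subset of the ambient space. -/
def IsSmoothOn {F : Type*} [NormedAddCommGroup F] [NormedSpace ℝ F] (N : Set E) (f : E → F) :
    Prop :=
  ∀ p ∈ N, ∃ U : Set E, IsOpen U ∧ p ∈ U ∧
    ∃ f' : E → F, ContDiffOn ℝ ∞ f' U ∧ Set.EqOn f f' (N ∩ U)

/-- Smooth (tangential) vector fields on `N`. -/
structure IsVectorField (N : Set E) (X : E → E) : Prop where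
  smooth : IsSmoothOn N X
  tangent : ∀ p ∈ N, X p ∈ tangentConeAt ℝ N p

/-- `D X Y = ∇_X Y` is the Levi-Civita connection of the metric `g` on `N`: an affine connection
which is torsion-free and compatible with `g`. -/
structure IsLeviCivita (N : Set E) (g : E → E → E → ℝ) (D : (E → E) → (E → E) → (E → E)) :
    Prop where
  isVectorField : ∀ X Y, IsVectorField N X → IsVectorField N Y → IsVectorField N (D X Y)
  add_left : ∀ X X' Y, IsVectorField N X → IsVectorField N X' → IsVectorField N Y →
    ∀ p ∈ N, D (X + X') Y p = D X Y p + D X' Y p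
  smul_left : ∀ (f : E → ℝ) X Y, IsSmoothOn N f → IsVectorField N X → IsVectorField N Y →
    ∀ p ∈ N, D (fun x => f x • X x) Y p = f p • D X Y p
  add_right : ∀ X Y Y', IsVectorField N X → IsVectorField N Y → IsVectorField N Y' →
    ∀ p ∈ N, D X (Y + Y') p = D X Y p + D X Y' p
  leibniz : ∀ (f : E → ℝ) X Y, IsSmoothOn N f → IsVectorField N X → IsVectorField N Y →
    ∀ p ∈ N, D X (fun x => f x • Y x) p = f p • D X Y p + fderivWithin ℝ f N p (X p) • Y p
  torsion_free : ∀ X Y, IsVectorField N X → IsVectorField N Y →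
    ∀ p ∈ N, D X Y p - D Y X p = VectorField.lieBracketWithin ℝ X Y N p
  metric : ∀ X Y Z, IsVectorField N X → IsVectorField N Y → IsVectorField N Z →
    ∀ p ∈ N, fderivWithin ℝ (fun x => g x (Y x) (Z x)) N p (X p)
      = g p (D X Y p) (Z p) + g p (Y p) (D X Z p)

/-- The curvature `R(X, Y) Z = ∇_X ∇_Y Z - ∇_Y ∇_X Z - ∇_{[X, Y]} Z`. -/
def curvature (N : Set E) (D : (E → E) → (E → E) → (E → E)) (X Y Z : E → E) : E → E :=
  D X (D Y Z) - D Y (D X Z) - D (VectorField.lieBracketWithin ℝ X Y N) Z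

/-- The bundle `Gr₂(TN)` of two-dimensional subspaces of the tangent spaces of `N`. -/
structure TangentPlane (N : Set E) where
  point : E
  point_mem : point ∈ N
  plane : Submodule ℝ E
  tangent : (plane : Set E) ⊆ tangentConeAt ℝ N point
  finrank_eq : Module.finrank ℝ plane = 2

/-- `κ : Gr₂(TN) → ℝ` is the sectional curvature of the Levi-Civita connection of `g` on `N`. The
Levi-Civita connection exists, and the value of `κ` on a plane `P ⊆ T_p N` is
`g(R(X, Y) Y, X) / (g(X, X) g(Y, Y) - g(X, Y)²)` at `p`, whichever vector fields `X`, `Y` on `N`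
are chosen such that `X p`, `Y p` span `P`. -/
def IsSectionalCurvature (N : Set E) (g : E → E → E → ℝ) (κ : TangentPlane N → ℝ) : Prop :=
  (∃ D, IsLeviCivita N g D) ∧
  ∀ D, IsLeviCivita N g D → ∀ X Y : E → E, IsVectorField N X → IsVectorField N Y →
    ∀ P : TangentPlane N, Submodule.span ℝ {X P.point, Y P.point} = P.plane →
      κ P = g P.point (curvature N D X Y Y P.point) (X P.point) /
        (g P.point (X P.point) (X P.point) * g P.point (Y P.point) (Y P.point)
          - g P.point (X P.point) (Y P.point) ^ 2)

end SubmanifoldGeometry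

/-! ## The hyper-Lie Poisson structure on triples in `𝔰𝔲(2)` -/

namespace HyperLiePoisson

-- The commutator bracket and a norm on matrices.
attribute [local instance] LieRing.ofAssociativeRing
attribute [local instance] Matrix.frobeniusNormedAddCommGroup Matrix.frobeniusNormedSpace

/-- The real Lie algebra `𝔰𝔲(2)` of traceless skew-Hermitian complex `2 × 2` matrices. -/
def su2 : LieSubalgebra ℝ (Matrix (Fin 2) (Fin 2) ℂ) where
  carrier := {A | A.conjTranspose = -A ∧ A.trace = 0}
  add_mem' := by
    rintro A B ⟨hA, hA'⟩ ⟨hB, hB'⟩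
    exact ⟨by rw [Matrix.conjTranspose_add, hA, hB]; abel,
      by rw [Matrix.trace_add, hA', hB', add_zero]⟩
  zero_mem' := by simp
  smul_mem' := by
    rintro c A ⟨hA, hA'⟩
    exact ⟨by rw [Matrix.conjTranspose_smul, hA]; simp, by rw [Matrix.trace_smul, hA', smul_zero]⟩
  lie_mem' := by
    rintro A B ⟨hA, hA'⟩ ⟨hB, hB'⟩
    refine ⟨?_, ?_⟩
    · rw [Ring.lie_def, Matrix.conjTranspose_sub, Matrix.conjTranspose_mul,
        Matrix.conjTranspose_mul, hA, hB]
      simp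
    · rw [Ring.lie_def, Matrix.trace_sub, Matrix.trace_mul_comm, sub_self]

/-- A norm on the finite-dimensional space `𝔰𝔲(2)`; only its topology matters. -/
instance su2NormedAddCommGroup : NormedAddCommGroup su2 :=
  inferInstanceAs (NormedAddCommGroup su2.toSubmodule)

instance su2NormedSpace : NormedSpace ℝ su2 :=
  inferInstanceAs (NormedSpace ℝ su2.toSubmodule)

/-- The space `𝔰𝔲(2)³` of triples `(a₁, a₂, a₃) = (a 0, a 1, a 2)`. -/
abbrev Triple : Type := Fin 3 → su2

/-- The invariant inner product on `𝔰𝔲(2)`: the Killing form, normalized (by the factor `-1/2`) to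
be positive definite and such that `[e₁, e₂] = e₃` for positively oriented orthonormal bases, i.e.
such that the bracket is the cross product. -/
def ip (x y : su2) : ℝ := -(1 / 2) * killingForm ℝ su2 x y

/-- `Φ(a₁, a₂, a₃) = ⟨a₁, [a₂, a₃]⟩`. -/
def Phi (a : Triple) : ℝ := ip (a 0) ⁅a 1, a 2⁆

/-- The covector on `𝔰𝔲(2)³` given by a triple `ξ`, i.e. the differential of
`l¹_{ξ₁} + l²_{ξ₂} + l³_{ξ₃}` where `lʲ_x(a) = ⟨x, aⱼ⟩`. Every covector has this form for exactly
one `ξ`. -/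
def pair (ξ v : Triple) : ℝ := ∑ j, ip (ξ j) (v j)

/-- The symmetric tensor
`A = Φ⁻¹ ([a₁,a₂] ⊗ [a₁,a₂] + [a₂,a₃] ⊗ [a₂,a₃] + [a₃,a₁] ⊗ [a₃,a₁])`, contracted with `x`, `y`. -/
def tensorA (a : Triple) (x y : su2) : ℝ :=
  (Phi a)⁻¹ * (ip ⁅a 0, a 1⁆ x * ip ⁅a 0, a 1⁆ y + ip ⁅a 1, a 2⁆ x * ip ⁅a 1, a 2⁆ y
    + ip ⁅a 2, a 0⁆ x * ip ⁅a 2, a 0⁆ y)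

/-- The bivector `π₁` at `a`, evaluated on the covectors `ξ` and `ζ`:
`{l¹_x, l¹_y} = l¹_[x,y]`, `{l¹_x, l²_y} = {l²_x, l¹_y} = l²_[x,y]`, `{l²_x, l²_y} = -l¹_[x,y]`,
`{l¹_x, l³_y} = {l³_x, l¹_y} = l³_[x,y]`, `{l³_x, l³_y} = -l¹_[x,y]`,
`{l²_x, l³_y} = -{l³_x, l²_y} = A_{x,y}`. -/
def poissonOne (a ξ ζ : Triple) : ℝ :=
  ip ⁅ξ 0, ζ 0⁆ (a 0) + (ip ⁅ξ 0, ζ 1⁆ (a 1) + ip ⁅ξ 1, ζ 0⁆ (a 1)) - ip ⁅ξ 1, ζ 1⁆ (a 0)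
    + (ip ⁅ξ 0, ζ 2⁆ (a 2) + ip ⁅ξ 2, ζ 0⁆ (a 2)) - ip ⁅ξ 2, ζ 2⁆ (a 0)
    + (tensorA a (ξ 1) (ζ 2) - tensorA a (ξ 2) (ζ 1))

/-- The bivectors `π₁, π₂, π₃` (for `k = 0, 1, 2`), where `π₂ = σ_* π₁`, `π₃ = σ_* π₂` are the
push-forwards under the cyclic permutation `σ (a₁, a₂, a₃) = (a₃, a₁, a₂)`. -/
def poisson (k : Fin 3) (a ξ ζ : Triple) : ℝ :=
  poissonOne (fun j => a (j + k)) (fun j => ξ (j + k)) (fun j => ζ (j + k))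

/-- The bundle map `π_k^♯` at `a`, from covectors to vectors, characterized by
`⟨ζ, π_k^♯ ξ⟩ = π_k(ξ, ζ)`. -/
def sharp (k : Fin 3) (a ξ : Triple) : Triple :=
  Classical.epsilon fun v => ∀ ζ, pair ζ v = poisson k a ξ ζ

/-- The symplectic form `ω_{k+1}` induced on the symplectic leaf through `a` by `π_{k+1}`, as the
map `ω^♭ = (π^♯)⁻¹` from tangent vectors of the leaf, i.e. vectors in the range of `π^♯`, to
covectors. As a covector on the ambient space the value is determined up to covectors that vanish
on the leaf. -/
def flat (k : Fin 3) (a u : Triple) : Triple :=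
  Function.invFun (sharp k a) u

/-- The hyperkähler metric on the leaves: `g^♭ = ω₃^♭ ∘ (ω₁^♭)⁻¹ ∘ ω₂^♭`. -/
def metric (a u v : Triple) : ℝ :=
  pair (flat 2 a (sharp 0 a (flat 1 a u))) v

/-- The leaf `N_{q,r}`. -/
def leaf (q r : ℝ) : Set Triple :=
  {a | Phi a < 0 ∧ (∀ i j, i ≠ j → ip (a i) (a j) = 0) ∧
    ip (a 0) (a 0) - ip (a 1) (a 1) = q ∧ ip (a 1) (a 1) - ip (a 2) (a 2) = r}

end HyperLiePoisson

end

/-! ### Differentiation along a submanifold. -/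

noncomputable section

namespace SubmanifoldGeometry

open Set Filter Topology

variable {E : Type*} [NormedAddCommGroup E] [NormedSpace ℝ E]
variable {F : Type*} [NormedAddCommGroup F] [NormedSpace ℝ F]
variable {G : Type*} [NormedAddCommGroup G] [NormedSpace ℝ G]
variable {N O : Set E} {p : E}

theorem fderivWithin_apply_of_tangent {f : E → F} {f' : E →L[ℝ] F} {v : E}
    (h : HasFDerivWithinAt f f' N p) (hv : v ∈ tangentConeAt ℝ N p) :
    fderivWithin ℝ f N p v = f' v :=
  (h.differentiableWithinAt.hasFDerivWithinAt).unique_on h hv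

namespace IsSmoothOn

theorem of_contDiffOn {f : E → F} (hO : IsOpen O) (hN : N ⊆ O) (hf : ContDiffOn ℝ ∞ f O) :
    IsSmoothOn N f :=
  fun _ hp => ⟨O, hO, hN hp, f, hf, fun _ _ => rfl⟩

theorem congr {f g : E → F} (hf : IsSmoothOn N f) (h : EqOn g f N) : IsSmoothOn N g := by
  intro p hp
  obtain ⟨U, hU, hpU, f', hf', he⟩ := hf p hp
  exact ⟨U, hU, hpU, f', hf', fun x hx => (h hx.1).trans (he hx)⟩

theorem differentiableWithinAt {f : E → F} (hf : IsSmoothOn N f) (hp : p ∈ N) :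
    DifferentiableWithinAt ℝ f N p := by
  obtain ⟨U, hU, hpU, f', hf', he⟩ := hf p hp
  have h1 : DifferentiableWithinAt ℝ f' N p :=
    ((hf'.differentiableOn (by simp)).differentiableAt (hU.mem_nhds hpU)).differentiableWithinAt
  refine h1.congr_of_eventuallyEq ?_ (he ⟨hp, hpU⟩)
  filter_upwards [self_mem_nhdsWithin, mem_nhdsWithin_of_mem_nhds (hU.mem_nhds hpU)] with x h1 h2
  exact he ⟨h1, h2⟩

theorem add {f g : E → F} (hf : IsSmoothOn N f) (hg : IsSmoothOn N g) :
    IsSmoothOn N (fun x => f x + g x) := by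
  intro p hp
  obtain ⟨U, hU, hpU, f', hf', he⟩ := hf p hp
  obtain ⟨W, hW, hpW, g', hg', he'⟩ := hg p hp
  exact ⟨U ∩ W, hU.inter hW, ⟨hpU, hpW⟩, fun x => f' x + g' x,
    (hf'.mono inter_subset_left).add (hg'.mono inter_subset_right), fun x hx => by
      simp only [he ⟨hx.1, hx.2.1⟩, he' ⟨hx.1, hx.2.2⟩]⟩

theorem sub {f g : E → F} (hf : IsSmoothOn N f) (hg : IsSmoothOn N g) :
    IsSmoothOn N (fun x => f x - g x) := by
  intro p hp
  obtain ⟨U, hU, hpU, f', hf', he⟩ := hf p hp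
  obtain ⟨W, hW, hpW, g', hg', he'⟩ := hg p hp
  exact ⟨U ∩ W, hU.inter hW, ⟨hpU, hpW⟩, fun x => f' x - g' x,
    (hf'.mono inter_subset_left).sub (hg'.mono inter_subset_right), fun x hx => by
      simp only [he ⟨hx.1, hx.2.1⟩, he' ⟨hx.1, hx.2.2⟩]⟩

theorem clm_apply {f : E → F →L[ℝ] G} {g : E → F} (hf : IsSmoothOn N f) (hg : IsSmoothOn N g) :
    IsSmoothOn N (fun x => f x (g x)) := by
  intro p hp
  obtain ⟨U, hU, hpU, f', hf', he⟩ := hf p hp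
  obtain ⟨W, hW, hpW, g', hg', he'⟩ := hg p hp
  exact ⟨U ∩ W, hU.inter hW, ⟨hpU, hpW⟩, fun x => f' x (g' x),
    (hf'.mono inter_subset_left).clm_apply (hg'.mono inter_subset_right), fun x hx => by
      simp only [he ⟨hx.1, hx.2.1⟩, he' ⟨hx.1, hx.2.2⟩]⟩

theorem smul {f : E → ℝ} {g : E → F} (hf : IsSmoothOn N f) (hg : IsSmoothOn N g) :
    IsSmoothOn N (fun x => f x • g x) := by
  intro p hp
  obtain ⟨U, hU, hpU, f', hf', he⟩ := hf p hp
  obtain ⟨W, hW, hpW, g', hg', he'⟩ := hg p hp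
  exact ⟨U ∩ W, hU.inter hW, ⟨hpU, hpW⟩, fun x => f' x • g' x,
    (hf'.mono inter_subset_left).smul (hg'.mono inter_subset_right), fun x hx => by
      simp only [he ⟨hx.1, hx.2.1⟩, he' ⟨hx.1, hx.2.2⟩]⟩

/-- Data of a local smooth extension near a point, with the derivative along `N`. -/
theorem exists_extension {f : E → F} (hf : IsSmoothOn N f) (hp : p ∈ N) :
    ∃ U : Set E, IsOpen U ∧ p ∈ U ∧ ∃ f' : E → F, ContDiffOn ℝ ∞ f' U ∧ EqOn f f' (N ∩ U) ∧
      ∀ x ∈ N ∩ U, HasFDerivWithinAt f (fderiv ℝ f' x) N x := by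
  obtain ⟨U, hU, hpU, f', hf', he⟩ := hf p hp
  refine ⟨U, hU, hpU, f', hf', he, fun x hx => ?_⟩
  have h1 : HasFDerivWithinAt f' (fderiv ℝ f' x) N x :=
    ((hf'.differentiableOn (by simp)).differentiableAt
      (hU.mem_nhds hx.2)).hasFDerivAt.hasFDerivWithinAt
  refine h1.congr_of_eventuallyEq ?_ (he hx)
  filter_upwards [self_mem_nhdsWithin, mem_nhdsWithin_of_mem_nhds (hU.mem_nhds hx.2)] with x h1 h2
  exact he ⟨h1, h2⟩

theorem derivative_along {f : E → F} {X : E → E} (hf : IsSmoothOn N f) (hX : IsVectorField N X) :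
    IsSmoothOn N (fun x => fderivWithin ℝ f N x (X x)) := by
  intro p hp
  obtain ⟨U, hU, hpU, f', hf', he, hd⟩ := hf.exists_extension hp
  obtain ⟨W, hW, hpW, X', hX', he'⟩ := hX.smooth p hp
  refine ⟨U ∩ W, hU.inter hW, ⟨hpU, hpW⟩, fun x => fderiv ℝ f' x (X' x), ?_, ?_⟩
  · exact ((hf'.fderiv_of_isOpen hU (by simp)).mono inter_subset_left).clm_apply
      (hX'.mono inter_subset_right)
  · intro x hx
    simp only
    rw [fderivWithin_apply_of_tangent (hd x ⟨hx.1, hx.2.1⟩) (hX.tangent x hx.1),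
      he' ⟨hx.1, hx.2.2⟩]

/-- Iterated derivatives along vector fields commute up to the Lie bracket. -/
theorem derivative_along_comm {f : E → F} {X Y : E → E} (hf : IsSmoothOn N f)
    (hX : IsVectorField N X) (hY : IsVectorField N Y) (hp : p ∈ N)
    (hXY : VectorField.lieBracketWithin ℝ X Y N p ∈ tangentConeAt ℝ N p) :
    fderivWithin ℝ (fun x => fderivWithin ℝ f N x (Y x)) N p (X p)
      - fderivWithin ℝ (fun x => fderivWithin ℝ f N x (X x)) N p (Y p)
      = fderivWithin ℝ f N p (VectorField.lieBracketWithin ℝ X Y N p) := by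
  obtain ⟨U, hU, hpU, f', hf', he, hd⟩ := hf.exists_extension hp
  have hf'p : ContDiffAt ℝ ∞ f' p := hf'.contDiffAt (hU.mem_nhds hpU)
  -- For an extension f' this reads X(Yf) = D²f'(X, Y) + Df'(DY·X); the Hessian term is symmetric
  -- and drops out of the commutator.
  have key : ∀ X Y : E → E, IsVectorField N X → IsVectorField N Y →
      fderivWithin ℝ (fun x => fderivWithin ℝ f N x (Y x)) N p (X p)
        = fderiv ℝ (fderiv ℝ f') p (X p) (Y p)
          + fderiv ℝ f' p (fderivWithin ℝ Y N p (X p)) := by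
    intro X Y hX hY
    have h1 : HasFDerivWithinAt (fderiv ℝ f') (fderiv ℝ (fderiv ℝ f') p) N p :=
      ((hf'p.fderiv_right (m := ∞) (by simp)).differentiableAt
        (by simp)).hasFDerivAt.hasFDerivWithinAt
    have h2 := h1.clm_apply (hY.smooth.differentiableWithinAt hp).hasFDerivWithinAt
    have h0 : ∀ x ∈ N ∩ U, fderivWithin ℝ f N x (Y x) = fderiv ℝ f' x (Y x) := fun x hx =>
      fderivWithin_apply_of_tangent (hd x hx) (hY.tangent x hx.1)
    have h3 := h2.congr_of_eventuallyEq (f₁ := fun x => fderivWithin ℝ f N x (Y x)) (by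
      filter_upwards [self_mem_nhdsWithin, mem_nhdsWithin_of_mem_nhds (hU.mem_nhds hpU)]
        with x h1 h2
      exact h0 x ⟨h1, h2⟩) (h0 p ⟨hp, hpU⟩)
    rw [fderivWithin_apply_of_tangent h3 (hX.tangent p hp)]
    simp [add_comm]
  have hsymm : fderiv ℝ (fderiv ℝ f') p (X p) (Y p) = fderiv ℝ (fderiv ℝ f') p (Y p) (X p) :=
    (hf'p.isSymmSndFDerivAt (by
      simp only [minSmoothness_of_isRCLikeNormedField]; exact WithTop.coe_le_coe.2 le_top)).eq _ _
  rw [key X Y hX hY, key Y X hY hX,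
    fderivWithin_apply_of_tangent (hd p ⟨hp, hpU⟩) hXY, hsymm]
  simp [VectorField.lieBracketWithin]

end IsSmoothOn

/-! ### Connection and curvature in a conformal frame. -/

/-- A smooth trivialization `V` (with inverse `θ`) of the tangent bundle of `N` by an inner product
space `F`, for which the metric `g` is conformal with factor `φ`, together with connection
coefficients `H` which are torsion-free and metric. -/
structure ConformalFrame {E F : Type*} [NormedAddCommGroup E] [NormedSpace ℝ E]
    [NormedAddCommGroup F] [InnerProductSpace ℝ F] (N O : Set E) (g : E → E → E → ℝ) (φ : E → ℝ)
    (V : E → F →L[ℝ] E) (θ : E → E →L[ℝ] F) (H : E → F →L[ℝ] F →L[ℝ] F) : Prop where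
  isOpen : IsOpen O
  subset : N ⊆ O
  smooth_φ : ContDiffOn ℝ ∞ φ O
  smooth_V : ContDiffOn ℝ ∞ V O
  smooth_θ : ContDiffOn ℝ ∞ θ O
  smooth_H : ContDiffOn ℝ ∞ H O
  mem_tangent : ∀ p ∈ N, ∀ y, V p y ∈ tangentConeAt ℝ N p
  V_θ : ∀ p ∈ N, ∀ v ∈ tangentConeAt ℝ N p, V p (θ p v) = v
  θ_V : ∀ p ∈ N, ∀ y, θ p (V p y) = y
  φ_pos : ∀ p ∈ N, 0 < φ p
  metric_eq : ∀ p ∈ N, ∀ x y, g p (V p x) (V p y) = φ p * inner ℝ x y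
  torsion : ∀ p ∈ N, ∀ x y,
    fderiv ℝ V p (V p x) y - fderiv ℝ V p (V p y) x = V p (H p x y - H p y x)
  compat : ∀ p ∈ N, ∀ u y z, fderiv ℝ φ p (V p u) * inner ℝ y z
    = φ p * (inner ℝ (H p u y) z + inner ℝ y (H p u z))

/-- The connection with coefficients `H` in the trivialization `V`. -/
def frameConnection {E F : Type*} [NormedAddCommGroup E] [NormedSpace ℝ E]
    [NormedAddCommGroup F] [NormedSpace ℝ F] (N : Set E)
    (V : E → F →L[ℝ] E) (θ : E → E →L[ℝ] F) (H : E → F →L[ℝ] F →L[ℝ] F) (X Y : E → E) : E → E :=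
  fun p => V p (fderivWithin ℝ (fun x => θ x (Y x)) N p (X p) + H p (θ p (X p)) (θ p (Y p)))

/-- The curvature of the connection with coefficients `H` in the trivialization `V`. -/
def frameCurvature {E F : Type*} [NormedAddCommGroup E] [NormedSpace ℝ E]
    [NormedAddCommGroup F] [NormedSpace ℝ F]
    (V : E → F →L[ℝ] E) (H : E → F →L[ℝ] F →L[ℝ] F) (p : E) (x y z : F) : F :=
  fderiv ℝ H p (V p x) y z - fderiv ℝ H p (V p y) x z - H p (H p x y - H p y x) z
    + (H p x (H p y z) - H p y (H p x z))

namespace ConformalFrame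

variable {E F : Type*} [NormedAddCommGroup E] [NormedSpace ℝ E]
    [NormedAddCommGroup F] [InnerProductSpace ℝ F] {N O : Set E} {g : E → E → E → ℝ} {φ : E → ℝ}
    {V : E → F →L[ℝ] E} {θ : E → E →L[ℝ] F} {H : E → F →L[ℝ] F →L[ℝ] F} {p : E} {X Y Z : E → E}

theorem isSmoothOn (h : ConformalFrame N O g φ V θ H) {G : Type*} [NormedAddCommGroup G]
    [NormedSpace ℝ G] {f : E → G} (hf : ContDiffOn ℝ ∞ f O) : IsSmoothOn N f :=
  .of_contDiffOn h.isOpen h.subset hf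

theorem hasFDerivWithinAt (h : ConformalFrame N O g φ V θ H) {G : Type*} [NormedAddCommGroup G]
    [NormedSpace ℝ G] {f : E → G} (hf : ContDiffOn ℝ ∞ f O) (hp : p ∈ N) :
    HasFDerivWithinAt f (fderiv ℝ f p) N p :=
  ((hf.differentiableOn (by simp)).differentiableAt
    (h.isOpen.mem_nhds (h.subset hp))).hasFDerivAt.hasFDerivWithinAt

theorem coord_smooth (h : ConformalFrame N O g φ V θ H) (hX : IsVectorField N X) :
    IsSmoothOn N (fun x => θ x (X x)) :=
  (h.isSmoothOn h.smooth_θ).clm_apply hX.smooth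

theorem coord_hasFDerivWithinAt (h : ConformalFrame N O g φ V θ H) (hX : IsVectorField N X)
    (hp : p ∈ N) : HasFDerivWithinAt (fun x => θ x (X x))
      (fderivWithin ℝ (fun x => θ x (X x)) N p) N p :=
  ((h.coord_smooth hX).differentiableWithinAt hp).hasFDerivWithinAt

theorem isVectorField (h : ConformalFrame N O g φ V θ H) {y : E → F} (hy : IsSmoothOn N y) :
    IsVectorField N (fun p => V p (y p)) :=
  ⟨(h.isSmoothOn h.smooth_V).clm_apply hy, fun p hp => h.mem_tangent p hp _⟩

theorem V_coord (h : ConformalFrame N O g φ V θ H) (hX : IsVectorField N X) (hp : p ∈ N) :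
    V p (θ p (X p)) = X p :=
  h.V_θ p hp _ (hX.tangent p hp)

theorem metric_apply (h : ConformalFrame N O g φ V θ H) (hp : p ∈ N) {u v : E}
    (hu : u ∈ tangentConeAt ℝ N p) (hv : v ∈ tangentConeAt ℝ N p) :
    g p u v = φ p * inner ℝ (θ p u) (θ p v) := by
  conv_lhs => rw [← h.V_θ p hp u hu, ← h.V_θ p hp v hv, h.metric_eq p hp]

/-- Apply the product rule to Y = V(θY): the antisymmetrized derivative of `V` is exactly what the
`torsion` field expresses through `H`. -/
theorem lieBracketWithin_eq (h : ConformalFrame N O g φ V θ H) (hX : IsVectorField N X)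
    (hY : IsVectorField N Y) (hp : p ∈ N) :
    VectorField.lieBracketWithin ℝ X Y N p
      = V p (fderivWithin ℝ (fun x => θ x (Y x)) N p (X p)
        - fderivWithin ℝ (fun x => θ x (X x)) N p (Y p)
        + (H p (θ p (X p)) (θ p (Y p)) - H p (θ p (Y p)) (θ p (X p)))) := by
  have key : ∀ X Y : E → E, IsVectorField N X → IsVectorField N Y →
      fderivWithin ℝ Y N p (X p) = fderiv ℝ V p (X p) (θ p (Y p))
        + V p (fderivWithin ℝ (fun x => θ x (Y x)) N p (X p)) := by
    intro X Y hX hY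
    have h1 := (h.hasFDerivWithinAt h.smooth_V hp).clm_apply (h.coord_hasFDerivWithinAt hY hp)
    have h2 := h1.congr (f₁ := Y) (fun x hx => (h.V_coord hY hx).symm) (h.V_coord hY hp).symm
    rw [fderivWithin_apply_of_tangent h2 (hX.tangent p hp)]
    simp [add_comm]
  have ht := h.torsion p hp (θ p (X p)) (θ p (Y p))
  rw [h.V_coord hX hp, h.V_coord hY hp] at ht
  rw [VectorField.lieBracketWithin, key X Y hX hY, key Y X hY hX, map_add, ← ht, map_sub]
  abel

theorem lieBracketWithin_isVectorField (h : ConformalFrame N O g φ V θ H)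
    (hX : IsVectorField N X) (hY : IsVectorField N Y) :
    IsVectorField N (VectorField.lieBracketWithin ℝ X Y N) := by
  have hx := h.coord_smooth hX
  have hy := h.coord_smooth hY
  have hH := h.isSmoothOn h.smooth_H
  have hs := h.isVectorField (((hy.derivative_along hX).sub (hx.derivative_along hY)).add
    (((hH.clm_apply hx).clm_apply hy).sub ((hH.clm_apply hy).clm_apply hx)))
  have he := fun p (hp : p ∈ N) => h.lieBracketWithin_eq hX hY hp
  exact ⟨hs.smooth.congr he, fun p hp => by rw [he p hp]; exact hs.tangent p hp⟩

theorem frameConnection_isVectorField (h : ConformalFrame N O g φ V θ H)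
    (hX : IsVectorField N X) (hY : IsVectorField N Y) :
    IsVectorField N (frameConnection N V θ H X Y) :=
  h.isVectorField (((h.coord_smooth hY).derivative_along hX).add
    (((h.isSmoothOn h.smooth_H).clm_apply (h.coord_smooth hX)).clm_apply (h.coord_smooth hY)))

/-- Torsion-freeness is the frame formula for the bracket; compatibility with `g` is the product
rule for φ⟨θY, θZ⟩ together with `compat`. -/
theorem isLeviCivita (h : ConformalFrame N O g φ V θ H) :
    IsLeviCivita N g (frameConnection N V θ H) where
  isVectorField X Y hX hY := h.frameConnection_isVectorField hX hY
  add_left X X' Y _ _ _ p _ := by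
    simp only [frameConnection, Pi.add_apply, map_add, add_apply]
    abel
  smul_left f X Y _ _ _ p _ := by
    simp only [frameConnection, map_smul, smul_apply, map_add, smul_add]
  add_right X Y Y' hX hY hY' p hp := by
    have h1 := (h.coord_hasFDerivWithinAt hY hp).add (h.coord_hasFDerivWithinAt hY' hp)
    have h2 : fderivWithin ℝ (fun x => θ x ((Y + Y') x)) N p (X p) = _ :=
      fderivWithin_apply_of_tangent (h1.congr (f₁ := fun x => θ x ((Y + Y') x))
        (fun x _ => by simp) (by simp)) (hX.tangent p hp)
    simp only [frameConnection, h2]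
    simp only [Pi.add_apply, map_add, add_apply]
    abel
  leibniz f X Y hf hX hY p hp := by
    have h1 := (hf.differentiableWithinAt hp).hasFDerivWithinAt.smul
      (h.coord_hasFDerivWithinAt hY hp)
    have h2 : fderivWithin ℝ (fun x => θ x (f x • Y x)) N p (X p) = _ :=
      fderivWithin_apply_of_tangent (h1.congr (f₁ := fun x => θ x (f x • Y x))
        (fun x _ => by simp) (by simp)) (hX.tangent p hp)
    simp only [frameConnection, h2]
    conv_rhs => rw [← h.V_coord hY hp]
    simp only [map_add, map_smul, add_apply, smul_apply,
      ContinuousLinearMap.smulRight_apply, smul_add]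
    simp only [h.V_coord hY hp]
    abel
  torsion_free X Y hX hY p hp := by
    rw [h.lieBracketWithin_eq hX hY hp]
    simp only [frameConnection, ← map_sub]
    congr 1
    abel
  metric X Y Z hX hY hZ p hp := by
    have h1 := (h.hasFDerivWithinAt h.smooth_φ hp).mul
      ((h.coord_hasFDerivWithinAt hY hp).inner ℝ (h.coord_hasFDerivWithinAt hZ hp))
    have he : ∀ x ∈ N, g x (Y x) (Z x) = φ x * inner ℝ (θ x (Y x)) (θ x (Z x)) := fun x hx =>
      h.metric_apply hx (hY.tangent x hx) (hZ.tangent x hx)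
    have h2 : fderivWithin ℝ (fun x => g x (Y x) (Z x)) N p (X p) = _ :=
      fderivWithin_apply_of_tangent (h1.congr (f₁ := fun x => g x (Y x) (Z x)) he (he p hp))
        (hX.tangent p hp)
    have hc := h.compat p hp (θ p (X p)) (θ p (Y p)) (θ p (Z p))
    rw [h.V_coord hX hp] at hc
    rw [h2, h.metric_apply hp ((h.frameConnection_isVectorField hX hY).tangent p hp)
        (hZ.tangent p hp), h.metric_apply hp (hY.tangent p hp)
        ((h.frameConnection_isVectorField hX hZ).tangent p hp)]
    simp only [frameConnection, h.θ_V p hp, inner_add_left, inner_add_right,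
      add_apply, smul_apply, smul_eq_mul,
      ContinuousLinearMap.comp_apply, ContinuousLinearMap.prod_apply, fderivInnerCLM_apply]
    linear_combination hc

/-- Two Levi-Civita connections agree. -/
theorem unique (h : ConformalFrame N O g φ V θ H) {D D' : (E → E) → (E → E) → (E → E)}
    (hD : IsLeviCivita N g D) (hD' : IsLeviCivita N g D') (hX : IsVectorField N X)
    (hY : IsVectorField N Y) (hp : p ∈ N) : D X Y p = D' X Y p := by
  -- The difference of two such connections is symmetric in X, Y, while ⟨S(X, Y), Z⟩ is skew in Y,
  -- Z; permuting the arguments cyclically forces it to vanish.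
  set S : (E → E) → (E → E) → F := fun X Y => θ p (D X Y p) - θ p (D' X Y p) with hS
  have hsymm : ∀ X Y, IsVectorField N X → IsVectorField N Y → S X Y = S Y X := by
    intro X Y hX hY
    have h1 := (hD.torsion_free X Y hX hY p hp).trans (hD'.torsion_free X Y hX hY p hp).symm
    have h2 := congrArg (θ p) h1
    simp only [map_sub] at h2
    exact sub_eq_sub_iff_sub_eq_sub.1 h2
  have hanti : ∀ X Y Z, IsVectorField N X → IsVectorField N Y → IsVectorField N Z →
      inner ℝ (S X Y) (θ p (Z p)) = - inner ℝ (S X Z) (θ p (Y p)) := by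
    intro X Y Z hX hY hZ
    have h1 := (hD.metric X Y Z hX hY hZ p hp).symm.trans (hD'.metric X Y Z hX hY hZ p hp)
    rw [h.metric_apply hp ((hD.isVectorField X Y hX hY).tangent p hp) (hZ.tangent p hp),
      h.metric_apply hp ((hD'.isVectorField X Y hX hY).tangent p hp) (hZ.tangent p hp),
      h.metric_apply hp (hY.tangent p hp) ((hD.isVectorField X Z hX hZ).tangent p hp),
      h.metric_apply hp (hY.tangent p hp) ((hD'.isVectorField X Z hX hZ).tangent p hp),
      ← mul_add, ← mul_add] at h1
    have h2 := mul_left_cancel₀ (h.φ_pos p hp).ne' h1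
    rw [hS]
    simp only [inner_sub_left]
    rw [real_inner_comm (θ p (Y p)) (θ p (D X Z p)), real_inner_comm (θ p (Y p))]
    linarith
  have hzero : ∀ Z, IsVectorField N Z → inner ℝ (S X Y) (θ p (Z p)) = 0 := by
    intro Z hZ
    have e1 := hanti X Y Z hX hY hZ
    have e2 := hanti Y Z X hY hZ hX
    have e3 := hanti Z X Y hZ hX hY
    rw [hsymm X Z hX hZ] at e1
    rw [hsymm Y X hY hX] at e2
    rw [hsymm Z Y hZ hY] at e3
    linarith
  -- The test field with constant coordinates S(X, Y) turns the orthogonality into |S(X, Y)|² = 0.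
  have hc : IsVectorField N (fun x => V x (S X Y)) := h.isVectorField (h.isSmoothOn contDiffOn_const)
  have h0 := hzero _ hc
  rw [h.θ_V p hp, inner_self_eq_zero, hS, sub_eq_zero] at h0
  rw [← h.V_θ p hp _ ((hD.isVectorField X Y hX hY).tangent p hp), h0,
    h.V_θ p hp _ ((hD'.isVectorField X Y hX hY).tangent p hp)]

theorem frameConnection_congr {Y' : E → E} (hYY : EqOn Y Y' N) (hp : p ∈ N) :
    frameConnection N V θ H X Y p = frameConnection N V θ H X Y' p := by
  simp only [frameConnection, hYY hp]
  rw [fderivWithin_congr (fun x hx => by rw [hYY hx]) (by rw [hYY hp])]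

/-- The second derivatives of the coordinates of Z cancel against the bracket term by
`derivative_along_comm`, and so do all first derivatives of coordinates, leaving a tensor. -/
theorem curvature_frameConnection (h : ConformalFrame N O g φ V θ H) (hX : IsVectorField N X)
    (hY : IsVectorField N Y) (hZ : IsVectorField N Z) (hp : p ∈ N) :
    curvature N (frameConnection N V θ H) X Y Z p
      = V p (frameCurvature V H p (θ p (X p)) (θ p (Y p)) (θ p (Z p))) := by
  have hz := h.coord_smooth hZ
  have hB := h.lieBracketWithin_isVectorField hX hY
  have key : ∀ X Y, IsVectorField N X → IsVectorField N Y →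
      fderivWithin ℝ (fun x => θ x (frameConnection N V θ H Y Z x)) N p (X p)
        = fderivWithin ℝ (fun x => fderivWithin ℝ (fun x => θ x (Z x)) N x (Y x)) N p (X p)
          + (fderiv ℝ H p (X p) (θ p (Y p)) (θ p (Z p))
            + H p (fderivWithin ℝ (fun x => θ x (Y x)) N p (X p)) (θ p (Z p))
            + H p (θ p (Y p)) (fderivWithin ℝ (fun x => θ x (Z x)) N p (X p))) := by
    intro X Y hX hY
    have h1 := ((hz.derivative_along hY).differentiableWithinAt hp).hasFDerivWithinAt.add
      (((h.hasFDerivWithinAt h.smooth_H hp).clm_apply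
        (h.coord_hasFDerivWithinAt hY hp)).clm_apply (h.coord_hasFDerivWithinAt hZ hp))
    have h2 := h1.congr (f₁ := fun x => θ x (frameConnection N V θ H Y Z x))
      (fun x hx => by simp [frameConnection, h.θ_V x hx]) (by simp [frameConnection, h.θ_V p hp])
    rw [fderivWithin_apply_of_tangent h2 (hX.tangent p hp)]
    simp
    abel
  have hcomm := hz.derivative_along_comm hX hY hp (hB.tangent p hp)
  have hbr : θ p (VectorField.lieBracketWithin ℝ X Y N p)
      = fderivWithin ℝ (fun x => θ x (Y x)) N p (X p)
        - fderivWithin ℝ (fun x => θ x (X x)) N p (Y p)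
        + (H p (θ p (X p)) (θ p (Y p)) - H p (θ p (Y p)) (θ p (X p))) := by
    rw [h.lieBracketWithin_eq hX hY hp, h.θ_V p hp]
  have hθ : ∀ Y, θ p (frameConnection N V θ H Y Z p) = fderivWithin ℝ (fun x => θ x (Z x)) N p (Y p)
      + H p (θ p (Y p)) (θ p (Z p)) := fun Y => by rw [frameConnection, h.θ_V p hp]
  change V p _ - V p _ - V p _ = _
  rw [← map_sub, ← map_sub, key X Y hX hY, key Y X hY hX, hθ, hθ, hbr, ← hcomm, frameCurvature,
    h.V_coord hX hp, h.V_coord hY hp]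
  congr 1
  simp only [map_add, map_sub, add_apply, sub_apply]
  abel

theorem curvature_eq (h : ConformalFrame N O g φ V θ H) {D : (E → E) → (E → E) → (E → E)}
    (hD : IsLeviCivita N g D) (hX : IsVectorField N X)
    (hY : IsVectorField N Y) (hZ : IsVectorField N Z) (hp : p ∈ N) :
    curvature N D X Y Z p
      = V p (frameCurvature V H p (θ p (X p)) (θ p (Y p)) (θ p (Z p))) := by
  have hu : ∀ X Y, IsVectorField N X → IsVectorField N Y →
      EqOn (D X Y) (frameConnection N V θ H X Y) N := fun X Y hX hY p hp =>
    h.unique hD h.isLeviCivita hX hY hp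
  -- `D Y Z` is known only on `N`, so the outer `D` is replaced first; the frame connection visibly
  -- depends only on values on `N`.
  have hu2 : ∀ X Y, IsVectorField N X → IsVectorField N Y →
      D X (D Y Z) p = frameConnection N V θ H X (frameConnection N V θ H Y Z) p :=
    fun X Y hX hY => (hu _ _ hX (hD.isVectorField Y Z hY hZ) hp).trans
      (frameConnection_congr (hu Y Z hY hZ) hp)
  rw [← h.curvature_frameConnection hX hY hZ hp]
  simp only [curvature, Pi.sub_apply]
  rw [hu2 X Y hX hY, hu2 Y X hY hX, hu _ _ (h.lieBracketWithin_isVectorField hX hY) hZ hp]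

end ConformalFrame

end SubmanifoldGeometry

end

noncomputable section

namespace HyperLiePoisson

open SubmanifoldGeometry
open scoped Quaternion

attribute [local instance] LieRing.ofAssociativeRing
attribute [local instance] Matrix.frobeniusNormedAddCommGroup Matrix.frobeniusNormedSpace

/-! ### `𝔰𝔲(2)` as ℝ³ with the cross product. -/

theorem su2_apply_one_zero (A : su2) : A.1 1 0 = - star (A.1 0 1) := by
  have := congrFun (congrFun A.2.1 1) 0
  simp only [Matrix.conjTranspose_apply, Matrix.neg_apply] at this
  rw [this, neg_neg]

theorem su2_apply_zero_zero (A : su2) : A.1 0 0 = ⟨0, (A.1 0 0).im⟩ := by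
  have := congrArg Complex.re (congrFun (congrFun A.2.1 0) 0)
  simp only [Matrix.conjTranspose_apply, Matrix.neg_apply, Complex.star_def, Complex.conj_re,
    Complex.neg_re] at this
  apply Complex.ext
  · simp only; linarith
  · rfl

theorem su2_apply_one_one (A : su2) : A.1 1 1 = - A.1 0 0 := by
  have := A.2.2
  rw [Matrix.trace_fin_two] at this
  linear_combination this

/-- Coordinates on `𝔰𝔲(2)` in which the bracket is the cross product. -/
def coord : su2 ≃ₗ[ℝ] (Fin 3 → ℝ) where
  -- These are the coordinates in the basis -iσ₁/2, -iσ₂/2, -iσ₃/2 built from the Pauli matrices.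
  toFun A := ![-2 * (A.1 0 1).im, -2 * (A.1 0 1).re, -2 * (A.1 0 0).im]
  map_add' A B := by
    ext i; fin_cases i <;> simp <;> ring
  map_smul' c A := by
    ext i; fin_cases i <;> simp <;> ring
  invFun x := ⟨!![⟨0, -x 2 / 2⟩, ⟨-x 1 / 2, -x 0 / 2⟩; ⟨x 1 / 2, -x 0 / 2⟩, ⟨0, x 2 / 2⟩], by
    constructor
    · ext i j
      fin_cases i <;> fin_cases j <;> apply Complex.ext <;> simp <;> ring
    · rw [Matrix.trace_fin_two]
      apply Complex.ext <;> simp <;> ring⟩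
  left_inv A := by
    apply Subtype.ext
    ext i j
    fin_cases i <;> fin_cases j
    · simp only [Fin.zero_eta, Matrix.of_apply, Matrix.cons_val]
      rw [su2_apply_zero_zero A]
      apply Complex.ext <;> simp
    · apply Complex.ext <;> simp
    · simp only [Fin.zero_eta, Fin.mk_one, Matrix.of_apply, Matrix.cons_val]
      rw [su2_apply_one_zero A]
      apply Complex.ext <;> simp <;> ring
    · simp only [Fin.mk_one, Matrix.of_apply, Matrix.cons_val]
      rw [su2_apply_one_one A, su2_apply_zero_zero A]
      apply Complex.ext <;> simp <;> ring
  right_inv x := by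
    ext i; fin_cases i <;> simp <;> ring

theorem coord_apply_zero (A : su2) : coord A 0 = -2 * (A.1 0 1).im := rfl
theorem coord_apply_one (A : su2) : coord A 1 = -2 * (A.1 0 1).re := rfl
theorem coord_apply_two (A : su2) : coord A 2 = -2 * (A.1 0 0).im := rfl

theorem lie_apply (A B : su2) (i j : Fin 2) : (⁅A, B⁆ : su2).1 i j
    = A.1 i 0 * B.1 0 j + A.1 i 1 * B.1 1 j - (B.1 i 0 * A.1 0 j + B.1 i 1 * A.1 1 j) := by
  change (A.1 * B.1 - B.1 * A.1) i j = _
  simp [Matrix.mul_apply, Fin.sum_univ_two]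

theorem coord_lie (A B : su2) : coord ⁅A, B⁆ = crossProduct (coord A) (coord B) := by
  ext i
  rw [cross_apply]
  fin_cases i
  · simp only [Fin.zero_eta, coord_apply_zero, coord_apply_one, coord_apply_two, lie_apply,
      su2_apply_one_one, Matrix.cons_val_zero]
    rw [su2_apply_zero_zero A, su2_apply_zero_zero B]
    simp; ring
  · simp only [Fin.mk_one, coord_apply_zero, coord_apply_one, coord_apply_two, lie_apply,
      su2_apply_one_one, Matrix.cons_val_one]
    rw [su2_apply_zero_zero A, su2_apply_zero_zero B]
    simp; ring
  · simp only [Fin.reduceFinMk, coord_apply_zero, coord_apply_one, coord_apply_two, lie_apply,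
      su2_apply_one_zero, Matrix.cons_val]
    rw [su2_apply_zero_zero A, su2_apply_zero_zero B]
    simp; ring

/-- The basis of `𝔰𝔲(2)` dual to the coordinates. -/
def coordBasis : Module.Basis (Fin 3) ℝ su2 := Module.Basis.ofEquivFun coord

theorem coord_coordBasis (i : Fin 3) : coord (coordBasis i) = Pi.single i 1 := by
  simp [coordBasis]

/-- The map z ↦ x × (y × z) has trace -2 x·y, which the factor -1/2 turns into the dot product. -/
theorem ip_eq_coord (x y : su2) : ip x y
    = coord x 0 * coord y 0 + coord x 1 * coord y 1 + coord x 2 * coord y 2 := by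
  rw [ip, LieModule.traceForm_apply_apply,
    LinearMap.trace_eq_matrix_trace ℝ coordBasis, Matrix.trace_fin_three]
  simp only [LinearMap.toMatrix_apply, LinearMap.comp_apply, LieModule.toEnd_apply_apply]
  have h : ∀ (z : su2) (i : Fin 3), coordBasis.repr z i = coord z i := fun z i => by
    simp [coordBasis]
  simp only [h, coord_lie, cross_apply, coord_coordBasis]
  simp
  ring

instance su2TopologicalSpace : TopologicalSpace su2 :=
  su2NormedAddCommGroup.toPseudoMetricSpace.toUniformSpace.toTopologicalSpace

instance : FiniteDimensional ℝ su2 := coordBasis.finiteDimensional_of_finite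

/-- The inner product as a continuous bilinear form. -/
def ipL : su2 →L[ℝ] su2 →L[ℝ] ℝ :=
  LinearMap.toContinuousLinearMap
    (LinearMap.toContinuousLinearMap.toLinearMap ∘ₗ (LinearMap.mk₂ ℝ ip
      (fun x y z => by simp only [ip_eq_coord, map_add, Pi.add_apply]; ring)
      (fun c x y => by simp only [ip_eq_coord, map_smul, Pi.smul_apply, smul_eq_mul]; ring)
      (fun x y z => by simp only [ip_eq_coord, map_add, Pi.add_apply]; ring)
      (fun c x y => by simp only [ip_eq_coord, map_smul, Pi.smul_apply, smul_eq_mul]; ring)))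

/-- The Lie bracket as a continuous bilinear map. -/
def lieL : su2 →L[ℝ] su2 →L[ℝ] su2 :=
  LinearMap.toContinuousLinearMap
    (LinearMap.toContinuousLinearMap.toLinearMap ∘ₗ (LinearMap.mk₂ ℝ (fun x y : su2 => ⁅x, y⁆)
      (fun x y z => add_lie x y z) (fun c x y => smul_lie c x y)
      (fun x y z => lie_add x y z) (fun c x y => lie_smul c x y)))

@[simp] theorem ipL_apply (x y : su2) : ipL x y = ip x y := rfl
@[simp] theorem lieL_apply (x y : su2) : lieL x y = ⁅x, y⁆ := rfl

theorem ip_add_left (x y z : su2) : ip (x + y) z = ip x z + ip y z := by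
  simp [← ipL_apply]
theorem ip_add_right (x y z : su2) : ip x (y + z) = ip x y + ip x z := by
  simp [← ipL_apply]
theorem ip_sub_left (x y z : su2) : ip (x - y) z = ip x z - ip y z := by
  simp [← ipL_apply]
theorem ip_sub_right (x y z : su2) : ip x (y - z) = ip x y - ip x z := by
  simp [← ipL_apply]
theorem ip_neg_right (x y : su2) : ip x (-y) = -ip x y := by
  simp [← ipL_apply]
theorem ip_smul_left (c : ℝ) (x y : su2) : ip (c • x) y = c * ip x y := by
  simp [← ipL_apply]
theorem ip_smul_right (c : ℝ) (x y : su2) : ip x (c • y) = c * ip x y := by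
  simp [← ipL_apply]
theorem ip_comm (x y : su2) : ip x y = ip y x := by
  simp only [ip_eq_coord]; ring

theorem coord_ext {x y : su2} (h0 : coord x 0 = coord y 0) (h1 : coord x 1 = coord y 1)
    (h2 : coord x 2 = coord y 2) : x = y :=
  coord.injective (by ext i; fin_cases i; exacts [h0, h1, h2])

theorem ip_self_pos {x : su2} (hx : x ≠ 0) : 0 < ip x x := by
  rw [ip_eq_coord]
  by_contra h
  apply hx
  have h0 := mul_self_nonneg (coord x 0)
  have h1 := mul_self_nonneg (coord x 1)
  have h2 := mul_self_nonneg (coord x 2)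
  refine coord_ext ?_ ?_ ?_ <;> simp only [map_zero, Pi.zero_apply] <;>
    exact mul_self_eq_zero.1 (by linarith)

theorem coord_lie_zero (x y : su2) :
    coord ⁅x, y⁆ 0 = coord x 1 * coord y 2 - coord x 2 * coord y 1 := by
  rw [coord_lie, cross_apply]; rfl
theorem coord_lie_one (x y : su2) :
    coord ⁅x, y⁆ 1 = coord x 2 * coord y 0 - coord x 0 * coord y 2 := by
  rw [coord_lie, cross_apply]; rfl
theorem coord_lie_two (x y : su2) :
    coord ⁅x, y⁆ 2 = coord x 0 * coord y 1 - coord x 1 * coord y 0 := by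
  rw [coord_lie, cross_apply]; rfl

/-- The expansion of a vector in terms of its inner products with a triple. -/
theorem triple_product_smul (x y z w : su2) :
    ip x ⁅y, z⁆ • w = ip w x • ⁅y, z⁆ + ip w y • ⁅z, x⁆ + ip w z • ⁅x, y⁆ := by
  refine coord_ext ?_ ?_ ?_ <;>
  simp only [ip_eq_coord, map_add, map_smul, Pi.add_apply, Pi.smul_apply, smul_eq_mul,
    coord_lie_zero, coord_lie_one, coord_lie_two] <;> ring

theorem ip_lie_lie (x y z w : su2) :
    ip ⁅x, y⁆ ⁅z, w⁆ = ip x z * ip y w - ip x w * ip y z := by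
  simp only [ip_eq_coord, coord_lie_zero, coord_lie_one, coord_lie_two]; ring

theorem ip_lie_cycle (x y z : su2) : ip y ⁅z, x⁆ = ip x ⁅y, z⁆ := by
  simp only [ip_eq_coord, coord_lie_zero, coord_lie_one, coord_lie_two]; ring

theorem ip_self_ne_zero_of_Phi {a : Triple} (h : Phi a ≠ 0) (i : Fin 3) : ip (a i) (a i) ≠ 0 := by
  refine (ip_self_pos fun h0 => h ?_).ne'
  fin_cases i <;> simp only [Fin.zero_eta, Fin.mk_one, Fin.reduceFinMk] at h0 <;>
    simp [Phi, h0, ← ipL_apply]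

/-! ### Slopes of an orthogonal triple. -/

/-- The ratios `Φ / |aᵢ|²`. -/
def slope (i : Fin 3) (a : Triple) : ℝ := Phi a / ip (a i) (a i)

/-- The relations satisfied by a nondegenerate orthogonal triple. -/
structure IsOrthogonal (a : Triple) : Prop where
  slope_ne : ∀ i, slope i a ≠ 0
  ip01 : ip (a 0) (a 1) = 0
  ip12 : ip (a 1) (a 2) = 0
  ip20 : ip (a 2) (a 0) = 0
  lie01 : ⁅a 0, a 1⁆ = slope 2 a • a 2
  lie12 : ⁅a 1, a 2⁆ = slope 0 a • a 0
  lie20 : ⁅a 2, a 0⁆ = slope 1 a • a 1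
  ip00 : ip (a 0) (a 0) = slope 1 a * slope 2 a
  ip11 : ip (a 1) (a 1) = slope 2 a * slope 0 a
  ip22 : ip (a 2) (a 2) = slope 0 a * slope 1 a
  Phi_eq : Phi a = slope 0 a * slope 1 a * slope 2 a

theorem isOrthogonal {a : Triple} (hΦ : Phi a ≠ 0) (h : ∀ i j, i ≠ j → ip (a i) (a j) = 0) :
    IsOrthogonal a := by
  have n0 := ip_self_ne_zero_of_Phi hΦ 0
  have n1 := ip_self_ne_zero_of_Phi hΦ 1
  have n2 := ip_self_ne_zero_of_Phi hΦ 2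
  have l12 : ⁅a 1, a 2⁆ = slope 0 a • a 0 := by
    have := triple_product_smul (a 0) (a 1) (a 2) (a 0)
    rw [h 0 1 (by decide), h 0 2 (by decide), zero_smul, zero_smul, add_zero, add_zero] at this
    rw [slope, Phi, div_eq_inv_mul, mul_smul, this, smul_smul, inv_mul_cancel₀ n0, one_smul]
  have l20 : ⁅a 2, a 0⁆ = slope 1 a • a 1 := by
    have := triple_product_smul (a 0) (a 1) (a 2) (a 1)
    rw [h 1 0 (by decide), h 1 2 (by decide), zero_smul, zero_smul, zero_add, add_zero] at this
    rw [slope, Phi, div_eq_inv_mul, mul_smul, this, smul_smul, inv_mul_cancel₀ n1, one_smul]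
  have l01 : ⁅a 0, a 1⁆ = slope 2 a • a 2 := by
    have := triple_product_smul (a 0) (a 1) (a 2) (a 2)
    rw [h 2 0 (by decide), h 2 1 (by decide), zero_smul, zero_smul, zero_add, zero_add] at this
    rw [slope, Phi, div_eq_inv_mul, mul_smul, this, smul_smul, inv_mul_cancel₀ n2, one_smul]
  -- Φ² is the Gram determinant of the triple, which is diagonal here; it yields the formulas for
  -- |aᵢ|² and Φ in the slopes.
  have hsq : Phi a ^ 2 = ip (a 0) (a 0) * ip (a 1) (a 1) * ip (a 2) (a 2) := by
    have h1 := ip_lie_lie (a 1) (a 2) (a 1) (a 2)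
    rw [h 1 2 (by decide), zero_mul, sub_zero] at h1
    have h2 : Phi a = slope 0 a * ip (a 0) (a 0) := by rw [Phi, l12, ip_smul_right]
    rw [l12, ip_smul_right, ip_smul_left] at h1
    rw [mul_assoc, ← h1, h2]; ring
  refine ⟨fun i => div_ne_zero hΦ (ip_self_ne_zero_of_Phi hΦ i), h 0 1 (by decide),
    h 1 2 (by decide), h 2 0 (by decide), l01, l12, l20, ?_, ?_, ?_, ?_⟩ <;>
  simp only [slope] <;> field_simp <;> rw [hsq] <;> ring

theorem isOrthogonal_of_mem_leaf {q r : ℝ} {a : Triple} (h : a ∈ leaf q r) : IsOrthogonal a :=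
  isOrthogonal h.1.ne h.2.1

/-! ### The tangent frame -/

/-- The module structure of the quaternions underlying their normed space structure. -/
instance quaternionModule : Module ℝ ℍ[ℝ] := (inferInstance : NormedSpace ℝ ℍ[ℝ]).toModule

/-- The vector fields `([a₁, a₂], [a₂, a₀], [a₀, a₁])` and `([aᵢ, aⱼ])ⱼ` for `i = 0, 1, 2` which
trivialize the tangent bundle of the leaves, polarized to bilinear maps. -/
def frameBilin (y : ℍ[ℝ]) : Triple →ₗ[ℝ] Triple →ₗ[ℝ] Triple :=
  LinearMap.mk₂ ℝ (fun a b j => y.re • ⁅a (j + 1), b (j + 2)⁆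
      + ⁅y.imI • a 0 + y.imJ • a 1 + y.imK • a 2, b j⁆)
    (fun a a' b => by ext1 j; simp only [Pi.add_apply, add_lie, smul_add]; abel)
    (fun c a b => by
      ext1 j
      simp only [Pi.smul_apply, add_lie, smul_lie, smul_add]; module)
    (fun a b b' => by ext1 j; simp only [Pi.add_apply, lie_add, smul_add]; abel)
    (fun c a b => by
      ext1 j
      simp only [Pi.smul_apply, lie_smul, smul_add]; module)

/-- The trivialization of the tangent bundle of the leaves. -/
def frame (a : Triple) : ℍ[ℝ] →L[ℝ] Triple :=
  LinearMap.toContinuousLinearMap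
    { toFun := fun y => frameBilin y a a
      map_add' := fun y y' => by
        ext1 j
        simp only [frameBilin, LinearMap.mk₂_apply, Pi.add_apply, Quaternion.re_add,
          Quaternion.imI_add, Quaternion.imJ_add, Quaternion.imK_add, add_smul, add_lie]
        abel
      map_smul' := fun c y => by
        ext1 j
        simp only [frameBilin, LinearMap.mk₂_apply, Pi.smul_apply, Quaternion.re_smul,
          Quaternion.imI_smul, Quaternion.imJ_smul, Quaternion.imK_smul, add_lie, smul_lie,
          RingHom.id_apply, smul_eq_mul]
        module }

theorem frame_apply (a : Triple) (y : ℍ[ℝ]) (j : Fin 3) :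
    frame a y j = y.re • ⁅a (j + 1), a (j + 2)⁆
      + ⁅y.imI • a 0 + y.imJ • a 1 + y.imK • a 2, a j⁆ := rfl

/-- The quaternion with given components. -/
def quat (a b c d : ℝ) : ℍ[ℝ] := ⟨a, b, c, d⟩

@[simp] theorem quat_re (a b c d : ℝ) : (quat a b c d).re = a := rfl
@[simp] theorem quat_imI (a b c d : ℝ) : (quat a b c d).imI = b := rfl
@[simp] theorem quat_imJ (a b c d : ℝ) : (quat a b c d).imJ = c := rfl
@[simp] theorem quat_imK (a b c d : ℝ) : (quat a b c d).imK = d := rfl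

theorem quat_eq (a b c d : ℝ) : quat a b c d = a • quat 1 0 0 0 + b • quat 0 1 0 0
    + c • quat 0 0 1 0 + d • quat 0 0 0 1 := by
  ext <;> simp

/-- The inverse of the trivialization `frame`. -/
def coframe (a : Triple) : Triple →L[ℝ] ℍ[ℝ] :=
  LinearMap.toContinuousLinearMap
    -- For v = `frame a x` each of these four products is Φ times one component of x, for instance
    -- ⟨v₀, a₀⟩ = x.re s₀ |a₀|² = x.re Φ.
    { toFun := fun v => (Phi a)⁻¹ •
        quat (ip (v 0) (a 0)) (ip (v 1) (a 2)) (ip (v 2) (a 0)) (ip (v 0) (a 1))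
      map_add' := fun v w => by
        simp only [Pi.add_apply, ip_add_left]
        ext <;> simp [mul_add]
      map_smul' := fun c v => by
        simp only [Pi.smul_apply, ip_smul_left]
        ext <;> simp <;> ring }

theorem coframe_apply (a v : Triple) : coframe a v = (Phi a)⁻¹ •
    quat (ip (v 0) (a 0)) (ip (v 1) (a 2)) (ip (v 2) (a 0)) (ip (v 0) (a 1)) := rfl

/-- The weights with which left multiplications by quaternion units enter the connection form. -/
def weight (a : Triple) (x : ℍ[ℝ]) : ℍ[ℝ] :=
  -- The real part is half the logarithmic derivative of Φ, as metricity demands; the imaginary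
  -- weights make the torsion vanish.
  quat ((slope 0 a + slope 1 a + slope 2 a) / 2 * x.re)
    (((slope 0 a + slope 1 a + slope 2 a) / 2 - slope 0 a) * x.imI)
    (((slope 0 a + slope 1 a + slope 2 a) / 2 - slope 1 a) * x.imJ)
    (((slope 0 a + slope 1 a + slope 2 a) / 2 - slope 2 a) * x.imK)

/-- The connection form of the Levi-Civita connection in the trivialization `frame`. -/
def connForm (a : Triple) : ℍ[ℝ] →L[ℝ] ℍ[ℝ] →L[ℝ] ℍ[ℝ] :=
  LinearMap.toContinuousLinearMap
    (LinearMap.toContinuousLinearMap.toLinearMap ∘ₗ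
      (LinearMap.mk₂ ℝ (fun x y : ℍ[ℝ] => weight a x * y)
      (fun x x' y => by rw [← add_mul]; congr 1; ext <;> simp [weight] <;> ring)
      (fun c x y => by rw [← smul_mul_assoc]; congr 1; ext <;> simp [weight] <;> ring)
      (fun x y y' => mul_add _ _ _) (fun c x y => mul_smul_comm _ _ _)))

theorem connForm_apply (a : Triple) (x y : ℍ[ℝ]) : connForm a x y = weight a x * y := rfl

theorem frame_zero {a : Triple} (h : IsOrthogonal a) (x : ℍ[ℝ]) : frame a x 0
    = (x.re * slope 0 a) • a 0 + (x.imK * slope 1 a) • a 1 - (x.imJ * slope 2 a) • a 2 := by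
  rw [frame_apply]
  simp only [zero_add, add_lie, smul_lie, lie_self, ← lie_skew (a 1) (a 0), h.lie01, h.lie12,
    h.lie20]
  module

theorem frame_one {a : Triple} (h : IsOrthogonal a) (x : ℍ[ℝ]) : frame a x 1
    = (x.re * slope 1 a) • a 1 + (x.imI * slope 2 a) • a 2 - (x.imK * slope 0 a) • a 0 := by
  rw [frame_apply]
  simp only [Fin.reduceAdd, add_lie, smul_lie, lie_self, ← lie_skew (a 2) (a 1), h.lie01,
    h.lie12, h.lie20]
  module

theorem frame_two {a : Triple} (h : IsOrthogonal a) (x : ℍ[ℝ]) : frame a x 2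
    = (x.re * slope 2 a) • a 2 + (x.imJ * slope 0 a) • a 0 - (x.imI * slope 1 a) • a 1 := by
  rw [frame_apply]
  simp only [Fin.reduceAdd, add_lie, smul_lie, lie_self, ← lie_skew (a 0) (a 2), h.lie01,
    h.lie12, h.lie20]
  module

theorem coframe_frame {a : Triple} (h : IsOrthogonal a) (x : ℍ[ℝ]) :
    coframe a (frame a x) = x := by
  have h0 := h.slope_ne 0
  have h1 := h.slope_ne 1
  have h2 := h.slope_ne 2
  rw [coframe_apply, frame_zero h, frame_one h, frame_two h, h.Phi_eq]
  ext <;> simp [ip_add_left, ip_sub_left, ip_smul_left, h.ip01, h.ip12, h.ip20, h.ip00, h.ip11,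
    h.ip22, ip_comm (a 1) (a 0), ip_comm (a 2) (a 1), ip_comm (a 0) (a 2)] <;> field_simp

/-! ### Derivatives -/

theorem hasFDerivAt_of_bilin {E G : Type*} [NormedAddCommGroup E] [NormedSpace ℝ E]
    [FiniteDimensional ℝ E] [NormedAddCommGroup G] [NormedSpace ℝ G] (B : E →ₗ[ℝ] E →ₗ[ℝ] G)
    (a : E) : ∃ f' : E →L[ℝ] G, HasFDerivAt (fun a => B a a) f' a ∧ ∀ u, f' u = B a u + B u a := by
  let B' : E →L[ℝ] E →L[ℝ] G := LinearMap.toContinuousLinearMap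
    (LinearMap.toContinuousLinearMap.toLinearMap ∘ₗ B)
  exact ⟨_, B'.hasFDerivAt_of_bilinear (hasFDerivAt_id a) (hasFDerivAt_id a), fun u => rfl⟩

theorem contDiff_of_bilin {E G : Type*} [NormedAddCommGroup E] [NormedSpace ℝ E]
    [FiniteDimensional ℝ E] [NormedAddCommGroup G] [NormedSpace ℝ G] (B : E →ₗ[ℝ] E →ₗ[ℝ] G) :
    ContDiff ℝ ∞ (fun a => B a a) := by
  let B' : E →L[ℝ] E →L[ℝ] G := LinearMap.toContinuousLinearMap
    (LinearMap.toContinuousLinearMap.toLinearMap ∘ₗ B)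
  change ContDiff ℝ ∞ (fun a => B' a a)
  fun_prop

theorem contDiff_frame : ContDiff ℝ ∞ frame :=
  contDiff_clm_apply_iff.2 fun y => contDiff_of_bilin (frameBilin y)

theorem fderiv_frame (a u : Triple) (y : ℍ[ℝ]) :
    fderiv ℝ frame a u y = frameBilin y a u + frameBilin y u a := by
  obtain ⟨f', hf, hu⟩ := hasFDerivAt_of_bilin (frameBilin y) a
  rw [← hu]
  have h1 := ((contDiff_frame.differentiable (by simp)) a).hasFDerivAt.clm_apply
    (hasFDerivAt_const y a)
  have h2 := HasFDerivAt.unique hf h1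
  rw [h2]
  simp

theorem hasFDerivAt_ip (i j : Fin 3) (a : Triple) : ∃ f' : Triple →L[ℝ] ℝ,
    HasFDerivAt (fun a : Triple => ip (a i) (a j)) f' a ∧
      ∀ u, f' u = ip (a i) (u j) + ip (u i) (a j) :=
  ⟨_, ipL.hasFDerivAt_of_bilinear (hasFDerivAt_apply (𝕜 := ℝ) i a)
    (hasFDerivAt_apply (𝕜 := ℝ) j a), fun _ => rfl⟩

theorem hasFDerivAt_Phi (a : Triple) : ∃ f' : Triple →L[ℝ] ℝ, HasFDerivAt Phi f' a ∧
    ∀ u, f' u = ip (a 0) (⁅a 1, u 2⁆ + ⁅u 1, a 2⁆) + ip (u 0) ⁅a 1, a 2⁆ :=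
  ⟨_, ipL.hasFDerivAt_of_bilinear (hasFDerivAt_apply (𝕜 := ℝ) (0 : Fin 3) a)
    (lieL.hasFDerivAt_of_bilinear (hasFDerivAt_apply (𝕜 := ℝ) (1 : Fin 3) a)
      (hasFDerivAt_apply (𝕜 := ℝ) (2 : Fin 3) a)), fun _ => rfl⟩

theorem contDiff_ip (i j : Fin 3) : ContDiff ℝ ∞ (fun a : Triple => ip (a i) (a j)) := by
  simp only [← ipL_apply]
  fun_prop

theorem contDiff_Phi : ContDiff ℝ ∞ Phi := by
  unfold Phi
  simp only [← ipL_apply, ← lieL_apply]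
  fun_prop

/-- The open set on which the leaves live. -/
def negPhi : Set Triple := {a | Phi a < 0}

theorem isOpen_negPhi : IsOpen negPhi :=
  isOpen_lt contDiff_Phi.continuous continuous_const

theorem contDiffOn_slope (i : Fin 3) : ContDiffOn ℝ ∞ (slope i) negPhi :=
  contDiff_Phi.contDiffOn.div (contDiff_ip i i).contDiffOn
    fun _ ha => ip_self_ne_zero_of_Phi (ne_of_lt ha) i

theorem contDiffOn_coframe : ContDiffOn ℝ ∞ coframe negPhi := by
  refine contDiffOn_clm_apply.2 fun v => ?_
  simp only [coframe_apply]
  conv => enter [3, a]; rw [quat_eq]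
  simp only [← ipL_apply]
  refine ContDiffOn.smul (contDiff_Phi.contDiffOn.inv fun _ ha => ne_of_lt ha) ?_
  fun_prop

theorem contDiffOn_weight (x : ℍ[ℝ]) : ContDiffOn ℝ ∞ (fun a => weight a x) negPhi := by
  have h0 := contDiffOn_slope 0
  have h1 := contDiffOn_slope 1
  have h2 := contDiffOn_slope 2
  simp only [weight]
  conv => enter [3, a]; rw [quat_eq]
  fun_prop

theorem contDiffOn_connForm : ContDiffOn ℝ ∞ connForm negPhi := by
  refine contDiffOn_clm_apply.2 fun x => contDiffOn_clm_apply.2 fun y => ?_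
  simp only [connForm_apply]
  exact (contDiffOn_weight x).mul contDiffOn_const

theorem ext_of_ip {a : Triple} (hΦ : Phi a ≠ 0) {x y : su2} (h0 : ip x (a 0) = ip y (a 0))
    (h1 : ip x (a 1) = ip y (a 1)) (h2 : ip x (a 2) = ip y (a 2)) : x = y := by
  have hx := triple_product_smul (a 0) (a 1) (a 2) x
  rw [h0, h1, h2, ← triple_product_smul (a 0) (a 1) (a 2) y] at hx
  exact smul_right_injective _ hΦ hx

theorem IsOrthogonal.Phi_ne {a : Triple} (h : IsOrthogonal a) : Phi a ≠ 0 := by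
  rw [h.Phi_eq]
  exact mul_ne_zero (mul_ne_zero (h.slope_ne 0) (h.slope_ne 1)) (h.slope_ne 2)

/-! ### Derivatives along the frame -/

theorem fderiv_Phi_frame {a : Triple} (h : IsOrthogonal a) (x : ℍ[ℝ]) :
    fderiv ℝ Phi a (frame a x) = x.re * (slope 0 a + slope 1 a + slope 2 a) * Phi a := by
  obtain ⟨f', hf, hu⟩ := hasFDerivAt_Phi a
  rw [hf.fderiv, hu, frame_zero h, frame_one h, frame_two h, h.Phi_eq]
  simp only [lie_add, lie_sub, lie_smul, add_lie, sub_lie, smul_lie, lie_self,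
    ← lie_skew (a 1) (a 0), ← lie_skew (a 0) (a 2), h.lie01, h.lie12, h.lie20, ip_add_left,
    ip_add_right, ip_sub_left, ip_sub_right, ip_smul_left, ip_smul_right, h.ip01, h.ip20,
    ip_comm (a 1) (a 0), ip_comm (a 0) (a 2), h.ip00,
    ip_neg_right, smul_neg]
  simp [← ipL_apply]
  ring

theorem ip_frame_self {a : Triple} (h : IsOrthogonal a) (x : ℍ[ℝ]) (i : Fin 3) :
    ip (a i) (frame a x i) = x.re * Phi a := by
  rw [h.Phi_eq]
  fin_cases i <;> simp only [Fin.zero_eta, Fin.mk_one, Fin.reduceFinMk, frame_zero h, frame_one h,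
    frame_two h, ip_add_right, ip_sub_right, ip_smul_right, h.ip01, h.ip12, h.ip20,
    ip_comm (a 1) (a 0), ip_comm (a 2) (a 1), ip_comm (a 0) (a 2), h.ip00, h.ip11, h.ip22] <;> ring

theorem slope_mul_ip {a : Triple} (h : IsOrthogonal a) (i : Fin 3) :
    slope i a * ip (a i) (a i) = Phi a :=
  div_mul_cancel₀ _ (ip_self_ne_zero_of_Phi h.Phi_ne i)

theorem hasFDerivAt_slope {a : Triple} (hΦ : Phi a < 0) (i : Fin 3) :
    HasFDerivAt (slope i) (fderiv ℝ (slope i) a) a :=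
  (((contDiffOn_slope i).differentiableOn (by simp)).differentiableAt
    (isOpen_negPhi.mem_nhds hΦ)).hasFDerivAt

/-- Differentiate sᵢ |aᵢ|² = Φ. Rotations change neither |aᵢ|² nor Φ; in the radial direction they
grow at the rates 2Φ and (s₀ + s₁ + s₂)Φ. -/
theorem fderiv_slope_frame {a : Triple} (hΦ : Phi a < 0) (h : IsOrthogonal a) (i : Fin 3)
    (x : ℍ[ℝ]) : fderiv ℝ (slope i) a (frame a x)
      = x.re * slope i a * (slope 0 a + slope 1 a + slope 2 a - 2 * slope i a) := by
  obtain ⟨f', hf, hu⟩ := hasFDerivAt_ip i i a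
  have h1 := (hasFDerivAt_slope hΦ i).fun_mul hf
  have h2 : (fun b : Triple => slope i b * ip (b i) (b i)) =ᶠ[nhds a] Phi := by
    filter_upwards [isOpen_negPhi.mem_nhds hΦ] with b hb
    exact div_mul_cancel₀ _ (ip_self_ne_zero_of_Phi (ne_of_lt hb) i)
  have h3 := fderiv_Phi_frame h x
  rw [← h2.fderiv_eq, HasFDerivAt.fderiv h1] at h3
  have hn := ip_self_ne_zero_of_Phi h.Phi_ne i
  simp only [add_apply, smul_apply, smul_eq_mul, hu,
    ip_comm (frame a x i), ip_frame_self h, ← slope_mul_ip h i] at h3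
  apply mul_right_cancel₀ hn
  linear_combination h3

/-- The frame fields are quadratic in a, so replacing brackets by multiples of the aᵢ turns both
sides into combinations of a₀, a₁, a₂ with coefficients polynomial in the slopes. -/
theorem frame_torsion {a : Triple} (h : IsOrthogonal a) (x y : ℍ[ℝ]) :
    fderiv ℝ frame a (frame a x) y - fderiv ℝ frame a (frame a y) x
      = frame a (connForm a x y - connForm a y x) := by
  rw [fderiv_frame, fderiv_frame]
  have e (y : ℍ[ℝ]) (a b : Triple) (j : Fin 3) : frameBilin y a b j = y.re • ⁅a (j + 1), b (j + 2)⁆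
    + ⁅y.imI • a 0 + y.imJ • a 1 + y.imK • a 2, b j⁆ := rfl
  ext1 j
  fin_cases j <;>
  simp only [Fin.zero_eta, Fin.mk_one, Fin.reduceFinMk, Pi.sub_apply, Pi.add_apply, e,
    Fin.reduceAdd, zero_add] <;>
  simp only [frame_zero h, frame_one h, frame_two h, lie_add, lie_sub, lie_smul, add_lie, sub_lie,
    smul_lie, lie_self, ← lie_skew (a 1) (a 0), ← lie_skew (a 0) (a 2), ← lie_skew (a 2) (a 1),
    h.lie01, h.lie12, h.lie20, connForm_apply, weight, Quaternion.re_sub, Quaternion.imI_sub,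
    Quaternion.imJ_sub, Quaternion.imK_sub, Quaternion.re_mul, Quaternion.imI_mul,
    Quaternion.imJ_mul, Quaternion.imK_mul, quat_re, quat_imI, quat_imJ, quat_imK] <;>
  module

theorem inner_eq (x y : ℍ[ℝ]) :
    inner ℝ x y = x.re * y.re + x.imI * y.imI + x.imJ * y.imJ + x.imK * y.imK := by
  rw [Quaternion.inner_def]
  simp

/-- Left multiplication by an imaginary quaternion is skew, so only the real part of `weight`
contributes. -/
theorem connForm_compat {a : Triple} (h : IsOrthogonal a) (u y z : ℍ[ℝ]) :
    fderiv ℝ (fun a => -Phi a) a (frame a u) * inner ℝ y z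
      = -Phi a * (inner ℝ (connForm a u y) z + inner ℝ y (connForm a u z)) := by
  rw [fderiv_fun_neg, neg_apply, fderiv_Phi_frame h]
  simp only [inner_eq, connForm_apply, weight, Quaternion.re_mul, Quaternion.imI_mul,
      Quaternion.imJ_mul, Quaternion.imK_mul, quat_re, quat_imI, quat_imJ, quat_imK]
  ring

/-! ### The tangent spaces of the leaves -/

/-- The rotation of `𝔰𝔲(2)` which is the Cayley transform of `ad w`. -/
def cayley (w y : su2) : su2 := y + (2 / (1 + ip w w)) • (⁅w, y⁆ + ⁅w, ⁅w, y⁆⁆)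

theorem ip_cayley (w y z : su2) : ip (cayley w y) (cayley w z) = ip y z := by
  have hn : 0 ≤ ip w w := by
    rw [ip_eq_coord]; nlinarith [mul_self_nonneg (coord w 0), mul_self_nonneg (coord w 1),
      mul_self_nonneg (coord w 2)]
  have hc : (2 / (1 + ip w w)) * (1 + ip w w) = 2 := div_mul_cancel₀ _ (by positivity)
  rw [cayley, cayley]
  set c := 2 / (1 + ip w w)
  -- For arbitrary c the failure to be orthogonal carries the factor 2 - c(1 + |w|²), which the
  -- chosen c kills.
  have : ip (y + c • (⁅w, y⁆ + ⁅w, ⁅w, y⁆⁆)) (z + c • (⁅w, z⁆ + ⁅w, ⁅w, z⁆⁆))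
      = ip y z + c * (2 - c * (1 + ip w w)) * ip ⁅w, ⁅w, y⁆⁆ z := by
    simp only [ip_eq_coord, map_add, map_smul, Pi.add_apply, Pi.smul_apply, smul_eq_mul,
      coord_lie_zero, coord_lie_one, coord_lie_two]
    ring
  rw [this, hc]
  ring

theorem hasDerivAt_cayley (w y : su2) : HasDerivAt (fun t : ℝ => cayley (t • w) y)
    ((2 : ℝ) • ⁅w, y⁆) 0 := by
  have he : (fun t : ℝ => cayley (t • w) y) = fun t : ℝ => y + (2 / (1 + t * (t * ip w w))) •
      (t • ⁅w, y⁆ + (t * t) • ⁅w, ⁅w, y⁆⁆) := by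
    funext t
    simp only [cayley, ip_smul_left, ip_smul_right, smul_lie, lie_smul, smul_smul]
  rw [he]
  have h1 : HasDerivAt (fun t : ℝ => 2 / (1 + t * (t * ip w w))) 0 0 := by
    have := (hasDerivAt_const (0 : ℝ) (2 : ℝ)).fun_div (((hasDerivAt_id (0 : ℝ)).fun_mul
      ((hasDerivAt_id (0 : ℝ)).mul_const (ip w w))).const_add 1) (by simp)
    simpa using this
  have h2 : HasDerivAt (fun t : ℝ => t • ⁅w, y⁆ + (t * t) • ⁅w, ⁅w, y⁆⁆) ⁅w, y⁆ 0 := by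
    have := ((hasDerivAt_id (0 : ℝ)).smul_const ⁅w, y⁆).fun_add
      (((hasDerivAt_id (0 : ℝ)).fun_mul (hasDerivAt_id (0 : ℝ))).smul_const ⁅w, ⁅w, y⁆⁆)
    simpa using this
  simpa using (h1.fun_smul h2).const_add y

theorem cayley_zero (y : su2) : cayley 0 y = y := by simp [cayley]

/-- The vector is the velocity of an explicit curve in the leaf: a common rotation of the triple
combined with a rescaling of each aᵢ. -/
theorem frame_mem_tangentConeAt {q r : ℝ} {a : Triple} (ha : a ∈ leaf q r) (x : ℍ[ℝ]) :
    frame a x ∈ tangentConeAt ℝ (leaf q r) a := by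
  have h := isOrthogonal_of_mem_leaf ha
  -- The 1/2 compensates the derivative 2 ad w of the Cayley transform.
  set w : su2 := (1 / 2 : ℝ) • (x.imI • a 0 + x.imJ • a 1 + x.imK • a 2) with hw
  -- Since sᵢ |aᵢ|² = Φ, this scaling adds the same amount 2t x.re Φ to every |aᵢ|², so the
  -- differences q and r are preserved.
  set ρ : Fin 3 → ℝ → ℝ := fun i t => √(1 + t * (2 * (x.re * slope i a))) with hρ
  set γ : ℝ → Triple := fun t i => ρ i t • cayley (t • w) (a i) with hγ
  have hγ0 : γ 0 = a := by
    ext1 i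
    simp [hγ, hρ, cayley_zero]
  have hρd : ∀ i, HasDerivAt (ρ i) (x.re * slope i a) 0 := by
    intro i
    have := (((hasDerivAt_id (0 : ℝ)).mul_const (2 * (x.re * slope i a))).const_add 1).sqrt
      (by simp)
    simpa [hρ] using this
  have hγd : HasDerivAt γ (frame a x) 0 := by
    rw [hasDerivAt_pi]
    intro i
    have h1 := (hρd i).fun_smul (hasDerivAt_cayley w (a i))
    convert h1 using 1
    have h2 : (2 : ℝ) • ⁅w, a i⁆ = ⁅x.imI • a 0 + x.imJ • a 1 + x.imK • a 2, a i⁆ := by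
      rw [hw, smul_lie, smul_smul]; norm_num
    have h3 : ⁅a (i + 1), a (i + 2)⁆ = slope i a • a i := by
      fin_cases i
      exacts [h.lie12, h.lie20, h.lie01]
    rw [frame_apply, h2, h3, zero_smul, cayley_zero]
    simp only [hρ, zero_mul, add_zero, Real.sqrt_one, one_smul, smul_smul]
    abel
  have hmem : ∀ᶠ t in nhds (0 : ℝ), γ t ∈ leaf q r := by
    have hcont : ContinuousAt (fun t => Phi (γ t)) 0 :=
      contDiff_Phi.continuous.continuousAt.comp hγd.continuousAt
    have e1 : ∀ᶠ t in nhds (0 : ℝ), Phi (γ t) < 0 :=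
      hcont.eventually_lt continuousAt_const (by rw [hγ0]; exact ha.1)
    have e2 : ∀ i, ∀ᶠ t in nhds (0 : ℝ), 0 < 1 + t * (2 * (x.re * slope i a)) := fun i =>
      ContinuousAt.eventually_lt continuousAt_const (by fun_prop) (by simp)
    filter_upwards [e1, Filter.eventually_all.2 e2] with t h1 h2
    have h4 : ∀ i, ip (γ t i) (γ t i) = ip (a i) (a i) + t * (2 * (x.re * Phi a)) := by
      intro i
      simp only [hγ, ip_smul_left, ip_smul_right, ip_cayley, hρ]
      rw [← mul_assoc, Real.mul_self_sqrt (h2 i).le, ← slope_mul_ip h i]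
      ring
    refine ⟨h1, fun i j hij => ?_, ?_, ?_⟩
    · simp only [hγ, ip_smul_left, ip_smul_right, ip_cayley, ha.2.1 i j hij, mul_zero]
    · rw [h4, h4, ← ha.2.2.1]; ring
    · rw [h4, h4, ← ha.2.2.2]; ring
  -- The times at which γ lies in the leaf form a neighbourhood of 0, whose tangent cone is all of
  -- ℝ.
  have h5 := HasFDerivWithinAt.mapsTo_tangent_cone
    (hγd.hasFDerivAt.hasFDerivWithinAt (s := {t | γ t ∈ leaf q r}))
  rw [tangentConeAt_of_mem_nhds hmem, hγ0] at h5
  have h6 := h5 (Set.mem_univ (1 : ℝ))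
  simp only [ContinuousLinearMap.toSpanSingleton_apply, one_smul] at h6
  exact tangentConeAt_mono (by rintro _ ⟨t, ht, rfl⟩; exact ht) h6

theorem hasFDerivAt_apply_eq_zero {E G : Type*} [NormedAddCommGroup E] [NormedSpace ℝ E]
    [NormedAddCommGroup G] [NormedSpace ℝ G] {N : Set E} {f : E → G} {f' : E →L[ℝ] G} {p v : E}
    (hf : HasFDerivAt f f' p) (hp : p ∈ N) (hc : ∀ x ∈ N, ∀ y ∈ N, f x = f y)
    (hv : v ∈ tangentConeAt ℝ N p) : f' v = 0 := by
  have h0 : HasFDerivWithinAt f (0 : E →L[ℝ] G) N p :=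
    (hasFDerivWithinAt_const (f p) p N).congr (fun x hx => hc x hx p hp) rfl
  exact hf.hasFDerivWithinAt.unique_on h0 hv

/-- The five differentiated equations of the leaf constrain the nine numbers ⟨vᵢ, aⱼ⟩, leaving free
the four that `coframe` records. -/
theorem frame_coframe {q r : ℝ} {a v : Triple} (ha : a ∈ leaf q r)
    (hv : v ∈ tangentConeAt ℝ (leaf q r) a) : frame a (coframe a v) = v := by
  have h := isOrthogonal_of_mem_leaf ha
  have hO : ∀ i j, i ≠ j → ip (a i) (v j) + ip (v i) (a j) = 0 := by
    intro i j hij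
    obtain ⟨f', hf, hu⟩ := hasFDerivAt_ip i j a
    rw [← hu]
    exact hasFDerivAt_apply_eq_zero hf ha
      (fun x hx y hy => by rw [hx.2.1 i j hij, hy.2.1 i j hij]) hv
  have hD : ip (a 0) (v 0) = ip (a 1) (v 1) ∧ ip (a 1) (v 1) = ip (a 2) (v 2) := by
    obtain ⟨f0, hf0, hu0⟩ := hasFDerivAt_ip 0 0 a
    obtain ⟨f1, hf1, hu1⟩ := hasFDerivAt_ip 1 1 a
    obtain ⟨f2, hf2, hu2⟩ := hasFDerivAt_ip 2 2 a
    have h1 := hasFDerivAt_apply_eq_zero (hf0.sub hf1) ha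
      (fun x hx y hy => hx.2.2.1.trans hy.2.2.1.symm) hv
    have h2 := hasFDerivAt_apply_eq_zero (hf1.sub hf2) ha
      (fun x hx y hy => hx.2.2.2.trans hy.2.2.2.symm) hv
    rw [sub_apply, hu0, hu1, ip_comm (v 0), ip_comm (v 1)] at h1
    rw [sub_apply, hu1, hu2, ip_comm (v 1), ip_comm (v 2)] at h2
    constructor <;> linarith
  have h01 := hO 0 1 (by decide)
  have h12 := hO 1 2 (by decide)
  have h20 := hO 2 0 (by decide)
  obtain ⟨hd0, hd1⟩ := hD
  simp only [ip_comm (a _) (v _)] at h01 h12 h20 hd0 hd1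
  rw [← hd0] at hd1
  replace h01 := eq_neg_of_add_eq_zero_left h01
  replace h12 := eq_neg_of_add_eq_zero_left h12
  replace h20 := eq_neg_of_add_eq_zero_left h20
  have n0 := h.slope_ne 0
  have n1 := h.slope_ne 1
  have n2 := h.slope_ne 2
  have hP := h.Phi_eq
  have hΦ := h.Phi_ne
  have key : ∀ j, ∀ l, ip (frame a (coframe a v) j) (a l) = ip (v j) (a l) := by
    intro j l
    fin_cases j <;> simp only [Fin.zero_eta, Fin.mk_one, Fin.reduceFinMk, frame_zero h,
      frame_one h, frame_two h] <;> fin_cases l <;>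
    simp only [Fin.zero_eta, Fin.mk_one, Fin.reduceFinMk, coframe_apply, Quaternion.re_smul,
      Quaternion.imI_smul, Quaternion.imJ_smul, Quaternion.imK_smul, quat_re, quat_imI, quat_imJ,
      quat_imK, smul_eq_mul, ip_add_left, ip_sub_left, ip_smul_left, h.ip01, h.ip12, h.ip20,
      ip_comm (a 1) (a 0), ip_comm (a 2) (a 1), ip_comm (a 0) (a 2), h.ip00, h.ip11, h.ip22, hP,
      h01, h12, h20, ← hd0, ← hd1] <;>
    field_simp <;> ring
  ext1 j
  exact ext_of_ip hΦ (key j 0) (key j 1) (key j 2)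

/-! ### The hyperkähler metric in the frame -/

theorem pair_ext {v w : Triple} (h : ∀ ζ, pair ζ v = pair ζ w) : v = w := by
  have h1 := h (v - w)
  have h2 : ∑ j, ip ((v - w) j) ((v - w) j) = 0 := by
    simp only [pair] at h1
    simp only [Pi.sub_apply, ip_sub_right, Finset.sum_sub_distrib] at h1 ⊢
    linarith
  have hn : ∀ x : su2, 0 ≤ ip x x := fun x => by
    rcases eq_or_ne x 0 with rfl | hx
    · simp [← ipL_apply]
    · exact (ip_self_pos hx).le
  rw [Finset.sum_eq_zero_iff_of_nonneg fun j _ => hn _] at h2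
  ext1 j
  by_contra hj
  exact (ip_self_pos (sub_ne_zero.2 hj)).ne' (h2 j (Finset.mem_univ j))

/-- The coordinates of the restriction of a covector to the tangent space of the leaf. -/
def dualCoord (a ξ : Triple) : ℍ[ℝ] :=
  quat (slope 0 a * ip (ξ 0) (a 0) + slope 1 a * ip (ξ 1) (a 1) + slope 2 a * ip (ξ 2) (a 2))
    (slope 2 a * ip (ξ 1) (a 2) - slope 1 a * ip (ξ 2) (a 1))
    (slope 0 a * ip (ξ 2) (a 0) - slope 2 a * ip (ξ 0) (a 2))
    (slope 1 a * ip (ξ 0) (a 1) - slope 0 a * ip (ξ 1) (a 0))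

theorem pair_frame {a : Triple} (h : IsOrthogonal a) (ξ : Triple) (x : ℍ[ℝ]) :
    pair ξ (frame a x) = inner ℝ (dualCoord a ξ) x := by
  rw [pair, Fin.sum_univ_three, frame_zero h, frame_one h, frame_two h, inner_eq]
  simp only [dualCoord, quat_re, quat_imI, quat_imJ, quat_imK, ip_add_right, ip_sub_right,
    ip_smul_right]
  ring

/-- The quaternion units `i, j, k`. -/
def unit : Fin 3 → ℍ[ℝ] := ![quat 0 1 0 0, quat 0 0 1 0, quat 0 0 0 1]

theorem unit_zero : unit 0 = quat 0 1 0 0 := rfl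
theorem unit_one : unit 1 = quat 0 0 1 0 := rfl
theorem unit_two : unit 2 = quat 0 0 0 1 := rfl

theorem unit_mul_self (k : Fin 3) : unit k * unit k = -1 := by
  fin_cases k <;> simp only [Fin.zero_eta, Fin.mk_one, Fin.reduceFinMk, unit_zero, unit_one,
    unit_two] <;> ext <;> simp

/-- The bracket terms become products of inner products through sᵢ⟨[x, y], aᵢ⟩ = ⟨[x, y], [aⱼ, aₖ]⟩
and the Lagrange identity; in `tensorA` each bracket is already a multiple of some aᵢ. -/
theorem poisson_eq {a : Triple} (h : IsOrthogonal a) (k : Fin 3) (ξ ζ : Triple) :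
    poisson k a ξ ζ = (-Phi a)⁻¹ * inner ℝ (dualCoord a ζ) (dualCoord a ξ * unit k) := by
  have n0 := h.slope_ne 0
  have n1 := h.slope_ne 1
  have n2 := h.slope_ne 2
  have hl0 : ∀ x y : su2, ip ⁅x, y⁆ (a 0)
      = (ip x (a 1) * ip y (a 2) - ip x (a 2) * ip y (a 1)) / slope 0 a := fun x y => by
    rw [← ip_lie_lie, h.lie12, ip_smul_right]; field_simp
  have hl1 : ∀ x y : su2, ip ⁅x, y⁆ (a 1)
      = (ip x (a 2) * ip y (a 0) - ip x (a 0) * ip y (a 2)) / slope 1 a := fun x y => by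
    rw [← ip_lie_lie, h.lie20, ip_smul_right]; field_simp
  have hl2 : ∀ x y : su2, ip ⁅x, y⁆ (a 2)
      = (ip x (a 0) * ip y (a 1) - ip x (a 1) * ip y (a 0)) / slope 2 a := fun x y => by
    rw [← ip_lie_lie, h.lie01, ip_smul_right]; field_simp
  have hPhi1 : Phi (fun j => a (j + 1)) = Phi a := ip_lie_cycle (a 0) (a 1) (a 2)
  have hPhi2 : Phi (fun j => a (j + 2)) = Phi a :=
    (ip_lie_cycle (a 1) (a 2) (a 0)).trans (ip_lie_cycle (a 0) (a 1) (a 2))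
  fin_cases k
  · simp only [Fin.zero_eta, poisson, poissonOne, tensorA, add_zero, h.lie01, h.lie12,
      h.lie20, hl0, hl1, hl2, ip_smul_left, inner_eq, dualCoord, unit_zero, Quaternion.re_mul,
      Quaternion.imI_mul, Quaternion.imJ_mul, Quaternion.imK_mul, quat_re, quat_imI, quat_imJ,
      quat_imK, h.Phi_eq, ip_comm (a _) (ξ _), ip_comm (a _) (ζ _)]
    field_simp
    ring
  · simp only [Fin.mk_one, poisson, poissonOne, tensorA, hPhi1, Fin.reduceAdd, zero_add, h.lie01,
      h.lie12, h.lie20, hl0, hl1, hl2, ip_smul_left, inner_eq, dualCoord, unit_one,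
      Quaternion.re_mul, Quaternion.imI_mul, Quaternion.imJ_mul, Quaternion.imK_mul, quat_re,
      quat_imI, quat_imJ, quat_imK, h.Phi_eq, ip_comm (a _) (ξ _), ip_comm (a _) (ζ _)]
    field_simp
    ring
  · simp only [Fin.reduceFinMk, poisson, poissonOne, tensorA, hPhi2, Fin.reduceAdd, zero_add,
      h.lie01, h.lie12, h.lie20, hl0, hl1, hl2, ip_smul_left, inner_eq, dualCoord, unit_two,
      Quaternion.re_mul, Quaternion.imI_mul, Quaternion.imJ_mul, Quaternion.imK_mul, quat_re,
      quat_imI, quat_imJ, quat_imK, h.Phi_eq, ip_comm (a _) (ξ _), ip_comm (a _) (ζ _)]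
    field_simp
    ring

/-- The right-hand side witnesses that the condition chosen by `epsilon` is solvable, and
nondegeneracy of `pair` makes the solution unique. -/
theorem sharp_eq {a : Triple} (h : IsOrthogonal a) (k : Fin 3) (ξ : Triple) :
    sharp k a ξ = frame a ((-Phi a)⁻¹ • (dualCoord a ξ * unit k)) := by
  have hs : ∀ ζ, pair ζ (frame a ((-Phi a)⁻¹ • (dualCoord a ξ * unit k))) = poisson k a ξ ζ := by
    intro ζ
    rw [pair_frame h, poisson_eq h, real_inner_smul_right]
  have he : ∀ ζ, pair ζ (sharp k a ξ) = poisson k a ξ ζ :=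
    Classical.epsilon_spec (p := fun v => ∀ ζ, pair ζ v = poisson k a ξ ζ) ⟨_, hs⟩
  exact pair_ext fun ζ => (he ζ).trans (hs ζ).symm

theorem exists_dualCoord_eq {a : Triple} (h : IsOrthogonal a) (y : ℍ[ℝ]) :
    ∃ ξ, dualCoord a ξ = y := by
  have n0 := h.slope_ne 0
  have n1 := h.slope_ne 1
  have n2 := h.slope_ne 2
  refine ⟨![(y.re / Phi a) • a 0 + (y.imK / Phi a) • a 1, (y.imI / Phi a) • a 2,
    (y.imJ / Phi a) • a 0], ?_⟩
  ext <;> simp [dualCoord, ip_add_left, ip_smul_left, h.ip01, h.ip12, h.ip20,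
      ip_comm (a 1) (a 0), ip_comm (a 2) (a 1), ip_comm (a 0) (a 2), h.ip00, h.ip11, h.ip22,
      h.Phi_eq] <;> field_simp

theorem frame_injective {a : Triple} (h : IsOrthogonal a) : Function.Injective (frame a) :=
  Function.LeftInverse.injective (coframe_frame h)

/-- `flat` picks an arbitrary preimage under `sharp`, but its restriction to the leaf is determined:
it inverts right multiplication by the unit over -Φ. -/
theorem dualCoord_flat_frame {a : Triple} (h : IsOrthogonal a) (k : Fin 3) (x : ℍ[ℝ]) :
    dualCoord a (flat k a (frame a x)) = Phi a • (x * unit k) := by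
  have hex : ∃ ξ, sharp k a ξ = frame a x := by
    obtain ⟨ξ, hξ⟩ := exists_dualCoord_eq h (Phi a • (x * unit k))
    refine ⟨ξ, ?_⟩
    rw [sharp_eq h, hξ, smul_mul_assoc, mul_assoc, unit_mul_self, smul_smul, inv_neg, neg_mul,
      inv_mul_cancel₀ h.Phi_ne]
    simp
  have h1 : sharp k a (flat k a (frame a x)) = frame a x := Function.invFun_eq hex
  rw [sharp_eq h] at h1
  have h2 := frame_injective h h1
  generalize dualCoord a (flat k a (frame a x)) = d at h2
  rw [← h2, smul_mul_assoc, mul_assoc, unit_mul_self, smul_smul, inv_neg, mul_neg,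
    mul_inv_cancel₀ h.Phi_ne]
  simp

/-- The three right multiplications compose to j i k = 1, so only the scalar -Φ survives. -/
theorem metric_frame {a : Triple} (h : IsOrthogonal a) (x y : ℍ[ℝ]) :
    metric a (frame a x) (frame a y) = -Phi a * inner ℝ x y := by
  have e : unit 1 * (unit 0 * unit 2) = 1 := by
    simp only [unit_zero, unit_one, unit_two]
    ext <;> simp
  rw [metric, pair_frame h, sharp_eq h, dualCoord_flat_frame h, dualCoord_flat_frame h,
    smul_mul_assoc, smul_smul, smul_mul_assoc, smul_mul_assoc, mul_assoc, mul_assoc, e, mul_one,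
    smul_smul, real_inner_smul_left, inv_neg, mul_neg, mul_inv_cancel₀ h.Phi_ne, neg_mul, one_mul]

/-! ### Curvature -/

theorem conformalFrame (q r : ℝ) : ConformalFrame (leaf q r) negPhi metric (fun a => -Phi a)
    frame coframe connForm where
  isOpen := isOpen_negPhi
  subset _ ha := ha.1
  smooth_φ := contDiff_Phi.neg.contDiffOn
  smooth_V := contDiff_frame.contDiffOn
  smooth_θ := contDiffOn_coframe
  smooth_H := contDiffOn_connForm
  mem_tangent _ ha y := frame_mem_tangentConeAt ha y
  V_θ _ ha _ hv := frame_coframe ha hv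
  θ_V _ ha y := coframe_frame (isOrthogonal_of_mem_leaf ha) y
  φ_pos _ ha := neg_pos.2 ha.1
  metric_eq _ ha x y := metric_frame (isOrthogonal_of_mem_leaf ha) x y
  torsion _ ha x y := frame_torsion (isOrthogonal_of_mem_leaf ha) x y
  compat _ ha u y z := connForm_compat (isOrthogonal_of_mem_leaf ha) u y z

/-- The derivative of `weight` along the radial vector field. -/
def weightDeriv (a : Triple) (y : ℍ[ℝ]) : ℍ[ℝ] :=
  let s := slope 0 a + slope 1 a + slope 2 a
  let d i := slope i a * (s - 2 * slope i a)
  quat ((d 0 + d 1 + d 2) / 2 * y.re) (((d 0 + d 1 + d 2) / 2 - d 0) * y.imI)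
    (((d 0 + d 1 + d 2) / 2 - d 1) * y.imJ) (((d 0 + d 1 + d 2) / 2 - d 2) * y.imK)

/-- The slopes are invariant under rotation, so only the radial component of x differentiates the
coefficients. -/
theorem fderiv_connForm_frame {a : Triple} (hΦ : Phi a < 0) (h : IsOrthogonal a)
    (x y z : ℍ[ℝ]) : fderiv ℝ connForm a (frame a x) y z = x.re • (weightDeriv a y * z) := by
  have h1 : HasFDerivAt connForm (fderiv ℝ connForm a) a :=
    ((contDiffOn_connForm.differentiableOn (by simp)).differentiableAt
      (isOpen_negPhi.mem_nhds hΦ)).hasFDerivAt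
  have h2 := (h1.clm_apply (hasFDerivAt_const y a)).clm_apply (hasFDerivAt_const z a)
  have s0 := hasFDerivAt_slope hΦ 0
  have s1 := hasFDerivAt_slope hΦ 1
  have s2 := hasFDerivAt_slope hΦ 2
  have s := ((s0.add s1).add s2).mul_const (1 / 2)
  have h3 := ((((((s.mul_const y.re).smul_const (quat 1 0 0 0)).add
    (((s.sub s0).mul_const y.imI).smul_const (quat 0 1 0 0))).add
    (((s.sub s1).mul_const y.imJ).smul_const (quat 0 0 1 0))).add
    (((s.sub s2).mul_const y.imK).smul_const (quat 0 0 0 1))).mul_const' z)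
  have h4 := h3.congr_of_eventuallyEq (f₁ := fun b => connForm b y z) (Filter.Eventually.of_forall
    fun b => by
      simp only [connForm_apply, weight]
      rw [quat_eq]
      simp only [Pi.add_apply, Pi.sub_apply, div_eq_mul_inv, one_mul])
  have h5 := congrArg (fun L => L (frame a x)) (h2.unique h4)
  simp only [add_apply, sub_apply, smul_apply, ContinuousLinearMap.comp_apply,
    ContinuousLinearMap.flip_apply, zero_apply, map_zero, zero_add,
    ContinuousLinearMap.smulRight_apply, fderiv_slope_frame hΦ h] at h5
  refine h5.trans ?_
  simp only [weightDeriv]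
  ext <;> simp <;> ring

/-- The self-dual components of the bivector `x ∧ y`. -/
def area (x y : ℍ[ℝ]) : Fin 3 → ℝ :=
  ![x.re * y.imI - x.imI * y.re + x.imJ * y.imK - x.imK * y.imJ,
    x.re * y.imJ - x.imJ * y.re + x.imK * y.imI - x.imI * y.imK,
    x.re * y.imK - x.imK * y.re + x.imI * y.imJ - x.imJ * y.imI]

theorem area_zero (x y : ℍ[ℝ]) : area x y 0
    = x.re * y.imI - x.imI * y.re + x.imJ * y.imK - x.imK * y.imJ := rfl
theorem area_one (x y : ℍ[ℝ]) : area x y 1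
    = x.re * y.imJ - x.imJ * y.re + x.imK * y.imI - x.imI * y.imK := rfl
theorem area_two (x y : ℍ[ℝ]) : area x y 2
    = x.re * y.imK - x.imK * y.re + x.imI * y.imJ - x.imJ * y.imI := rfl

theorem area_combination (x y : ℍ[ℝ]) (α β γ δ : ℝ) :
    area (α • x + β • y) (γ • x + δ • y) = (α * δ - β * γ) • area x y := by
  ext i
  fin_cases i <;> simp [area] <;> ring

/-- The eigenvalues of the curvature operator up to the factor `Φ`, in terms of the slopes. -/
def curvCoeff (a : Triple) (i : Fin 3) : ℝ :=
  slope i a ^ 2 - (slope (i + 1) a - slope (i + 2) a) ^ 2 / 2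
    - slope i a * (slope (i + 1) a + slope (i + 2) a) / 2

/-- R(x, y) is left multiplication by the imaginary quaternion with components cᵢ · `area x y i`,
and `area x y` is minus the imaginary part of x ȳ. -/
theorem inner_frameCurvature {a : Triple} (hΦ : Phi a < 0) (h : IsOrthogonal a) (x y : ℍ[ℝ]) :
    inner ℝ (frameCurvature frame connForm a x y y) x = -∑ i, curvCoeff a i * area x y i ^ 2 := by
  rw [frameCurvature, fderiv_connForm_frame hΦ h, fderiv_connForm_frame hΦ h, inner_eq,
    Fin.sum_univ_three]
  simp only [connForm_apply, weight, weightDeriv, curvCoeff, area_zero, area_one, area_two,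
    Fin.reduceAdd, zero_add, Quaternion.re_sub, Quaternion.imI_sub, Quaternion.imJ_sub,
    Quaternion.imK_sub, Quaternion.re_add, Quaternion.imI_add, Quaternion.imJ_add,
    Quaternion.imK_add, Quaternion.re_smul, Quaternion.imI_smul, Quaternion.imJ_smul,
    Quaternion.imK_smul, Quaternion.re_mul, Quaternion.imI_mul, Quaternion.imJ_mul,
    Quaternion.imK_mul, quat_re, quat_imI, quat_imJ, quat_imK, smul_eq_mul]
  ring

/-- |x|²|y|² = |x ȳ|² and ⟨x, y⟩ = Re(x ȳ), so the difference is |Im(x ȳ)|². -/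
theorem inner_mul_inner_sub (x y : ℍ[ℝ]) :
    inner ℝ x x * inner ℝ y y - inner ℝ x y ^ 2 = ∑ i, area x y i ^ 2 := by
  simp only [inner_eq, Fin.sum_univ_three, area_zero, area_one, area_two]
  ring

/-- The sectional curvature of the plane spanned by `frame a x` and `frame a y`. -/
def sectionalCurv (a : Triple) (x y : ℍ[ℝ]) : ℝ :=
  (∑ i, curvCoeff a i * area x y i ^ 2) / (Phi a * ∑ i, area x y i ^ 2)

theorem sectionalCurv_combination {a : Triple} {x y x' y' : ℍ[ℝ]} {α β γ δ α' β' γ' δ' : ℝ}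
    (hx : x' = α • x + β • y) (hy : y' = γ • x + δ • y) (hx' : x = α' • x' + β' • y')
    (hy' : y = γ' • x' + δ' • y') : sectionalCurv a x' y' = sectionalCurv a x y := by
  have h1 : area x' y' = (α * δ - β * γ) • area x y := by rw [hx, hy, area_combination]
  have h2 : area x y = (α' * δ' - β' * γ') • area x' y' := by
    conv_lhs => rw [hx', hy', area_combination]
  rcases eq_or_ne (α * δ - β * γ) 0 with h0 | h0
  -- With vanishing determinant both areas are zero, and both quotients are 0/0 = 0.
  · rw [h0, zero_smul] at h1
    rw [h1, smul_zero] at h2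
    simp [sectionalCurv, h1, h2]
  · have e1 : ∑ i, curvCoeff a i * area x' y' i ^ 2
        = (α * δ - β * γ) ^ 2 * ∑ i, curvCoeff a i * area x y i ^ 2 := by
      rw [Finset.mul_sum, h1]
      exact Finset.sum_congr rfl fun i _ => by simp only [Pi.smul_apply, smul_eq_mul]; ring
    have e2 : Phi a * ∑ i, area x' y' i ^ 2
        = (α * δ - β * γ) ^ 2 * (Phi a * ∑ i, area x y i ^ 2) := by
      rw [mul_left_comm, Finset.mul_sum (a := (α * δ - β * γ) ^ 2), h1]
      congr 1
      exact Finset.sum_congr rfl fun i _ => by simp only [Pi.smul_apply, smul_eq_mul]; ring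
    rw [sectionalCurv, sectionalCurv, e1, e2, mul_div_mul_left _ _ (pow_ne_zero 2 h0)]

theorem sectionalCurv_eq_of_span_eq {a u v u' v' : Triple}
    (h : Submodule.span ℝ {u', v'} = Submodule.span ℝ {u, v}) :
    sectionalCurv a (coframe a u') (coframe a v') = sectionalCurv a (coframe a u) (coframe a v) := by
  have m : ∀ u v u' v' : Triple, Submodule.span ℝ {u', v'} = Submodule.span ℝ {u, v} →
      (∃ α β : ℝ, coframe a u' = α • coframe a u + β • coframe a v) ∧
      ∃ α β : ℝ, coframe a v' = α • coframe a u + β • coframe a v := by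
    intro u v u' v' h
    have hu : u' ∈ Submodule.span ℝ {u, v} := h ▸ Submodule.subset_span (by simp)
    have hv : v' ∈ Submodule.span ℝ {u, v} := h ▸ Submodule.subset_span (by simp)
    obtain ⟨α, β, e⟩ := Submodule.mem_span_pair.1 hu
    obtain ⟨γ, δ, e'⟩ := Submodule.mem_span_pair.1 hv
    exact ⟨⟨α, β, by rw [← e, map_add, map_smul, map_smul]⟩,
      ⟨γ, δ, by rw [← e', map_add, map_smul, map_smul]⟩⟩
  obtain ⟨⟨α, β, h1⟩, γ, δ, h2⟩ := m u v u' v' h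
  obtain ⟨⟨α', β', h3⟩, γ', δ', h4⟩ := m u' v' u v h.symm
  exact sectionalCurv_combination h1 h2 h3 h4

theorem exists_span_pair {E : Type*} [AddCommGroup E] [Module ℝ E] {P : Submodule ℝ E}
    (h : Module.finrank ℝ P = 2) : ∃ w : E × E, Submodule.span ℝ {w.1, w.2} = P := by
  have : FiniteDimensional ℝ P := Module.finite_of_finrank_pos (by omega)
  let b := Module.finBasisOfFinrankEq ℝ P h
  refine ⟨(b 0, b 1), ?_⟩
  have h1 := congrArg (Submodule.map P.subtype) b.span_eq
  rw [Submodule.map_span, ← Set.range_comp, Submodule.map_top, Submodule.range_subtype] at h1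
  refine Eq.trans ?_ h1
  congr 1
  ext x
  simp [eq_comm]

/-- The sectional curvature of the leaf. -/
def leafCurvature (q r : ℝ) (P : TangentPlane (leaf q r)) : ℝ :=
  let w := (exists_span_pair P.finrank_eq).choose
  sectionalCurv P.point (coframe P.point w.1) (coframe P.point w.2)

theorem leafCurvature_eq {q r : ℝ} (P : TangentPlane (leaf q r)) {u v : Triple}
    (h : Submodule.span ℝ {u, v} = P.plane) :
    leafCurvature q r P = sectionalCurv P.point (coframe P.point u) (coframe P.point v) :=
  sectionalCurv_eq_of_span_eq ((exists_span_pair P.finrank_eq).choose_spec.trans h.symm)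

theorem isSectionalCurvature_leafCurvature (q r : ℝ) :
    IsSectionalCurvature (leaf q r) metric (leafCurvature q r) := by
  have hF := conformalFrame q r
  refine ⟨⟨_, hF.isLeviCivita⟩, fun D hD X Y hX hY P hP => ?_⟩
  have hp := P.point_mem
  have h := isOrthogonal_of_mem_leaf hp
  have hcurv := hF.curvature_eq hD hX hY hY hp
  have hn : metric P.point (curvature (leaf q r) D X Y Y P.point) (X P.point)
      = Phi P.point * ∑ i, curvCoeff P.point i
        * area (coframe P.point (X P.point)) (coframe P.point (Y P.point)) i ^ 2 := by
    rw [hcurv, hF.metric_apply hp (hF.mem_tangent _ hp _) (hX.tangent _ hp), hF.θ_V _ hp,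
      inner_frameCurvature hp.1 h]
    ring
  have hd : metric P.point (X P.point) (X P.point) * metric P.point (Y P.point) (Y P.point)
      - metric P.point (X P.point) (Y P.point) ^ 2 = Phi P.point * (Phi P.point *
        ∑ i, area (coframe P.point (X P.point)) (coframe P.point (Y P.point)) i ^ 2) := by
    rw [hF.metric_apply hp (hX.tangent _ hp) (hX.tangent _ hp),
      hF.metric_apply hp (hY.tangent _ hp) (hY.tangent _ hp),
      hF.metric_apply hp (hX.tangent _ hp) (hY.tangent _ hp), ← inner_mul_inner_sub]
    ring
  rw [leafCurvature_eq P hP, hn, hd, mul_div_mul_left _ _ h.Phi_ne, sectionalCurv]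

/-- The tangent plane spanned by the radial direction and the direction of a quaternion unit. -/
def radialPlane {q r : ℝ} {a : Triple} (ha : a ∈ leaf q r) (k : Fin 3) :
    TangentPlane (leaf q r) where
  point := a
  point_mem := ha
  plane := Submodule.span ℝ {frame a 1, frame a (unit k)}
  tangent := by
    intro v hv
    obtain ⟨α, β, rfl⟩ := Submodule.mem_span_pair.1 hv
    rw [← map_smul, ← map_smul, ← map_add]
    exact frame_mem_tangentConeAt ha _
  finrank_eq := by
    have hli : LinearIndependent ℝ ![frame a 1, frame a (unit k)] := by
      rw [LinearIndependent.pair_iff]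
      intro s t hst
      rw [← map_smul, ← map_smul, ← map_add] at hst
      have h0 := frame_injective (isOrthogonal_of_mem_leaf ha) (hst.trans (map_zero _).symm)
      have h1 := congrArg QuaternionAlgebra.re h0
      have h2 := congrArg QuaternionAlgebra.imI h0
      have h3 := congrArg QuaternionAlgebra.imJ h0
      have h4 := congrArg QuaternionAlgebra.imK h0
      fin_cases k <;> simp [unit] at h1 h2 h3 h4 <;> simp [*]
    have := finrank_span_eq_card hli
    rwa [Matrix.range_cons_cons_empty, Fintype.card_fin] at this

theorem leafCurvature_radialPlane {q r : ℝ} {a : Triple} (ha : a ∈ leaf q r) (k : Fin 3) :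
    leafCurvature q r (radialPlane ha k) = curvCoeff a k / Phi a := by
  have h := isOrthogonal_of_mem_leaf ha
  rw [leafCurvature_eq (radialPlane ha k) (u := frame a 1) (v := frame a (unit k)) rfl]
  change sectionalCurv a (coframe a (frame a 1)) (coframe a (frame a (unit k))) = _
  rw [coframe_frame h, coframe_frame h, sectionalCurv]
  have : area 1 (unit k) = Pi.single k 1 := by
    ext i
    fin_cases k <;> fin_cases i <;> simp [area, unit]
  rw [this]
  fin_cases k <;> simp [Fin.sum_univ_three]

/-- A mean of the cᵢ/Φ with weights `area x y i ^ 2` obeys any bound they share; `hC` covers the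
degenerate pair with zero area. -/
theorem abs_sectionalCurv_le {a : Triple} {x y : ℍ[ℝ]} {C : ℝ} (hC : 0 ≤ C)
    (h : ∀ i, |curvCoeff a i| ≤ C * |Phi a|) : |sectionalCurv a x y| ≤ C := by
  rw [sectionalCurv, abs_div, abs_mul]
  have hn : 0 ≤ ∑ i, area x y i ^ 2 := Finset.sum_nonneg fun i _ => sq_nonneg _
  rw [abs_of_nonneg hn]
  refine div_le_of_le_mul₀ (by positivity) hC ?_
  refine (Finset.abs_sum_le_sum_abs _ _).trans ?_
  rw [← mul_assoc, Finset.mul_sum]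
  refine Finset.sum_le_sum fun i _ => ?_
  rw [abs_mul, abs_of_nonneg (sq_nonneg (area x y i))]
  exact mul_le_mul_of_nonneg_right (h i) (sq_nonneg _)

/-! ### Explicit points of the leaves and the three cases. -/

/-- The orthogonal triple with lengths `l₀, l₁, l₂` along negatively oriented axes. -/
def axes (l : Fin 3 → ℝ) : Triple := fun i => coord.symm (Pi.single i (-l i))

theorem ip_axes_self (l : Fin 3 → ℝ) (i : Fin 3) : ip (axes l i) (axes l i) = l i ^ 2 := by
  fin_cases i <;> simp [ip_eq_coord, axes] <;> ring

theorem Phi_axes (l : Fin 3 → ℝ) : Phi (axes l) = -(l 0 * l 1 * l 2) := by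
  simp [Phi, ip_eq_coord, coord_lie_zero, coord_lie_one, coord_lie_two, axes]
  ring

theorem axes_mem_leaf {q r : ℝ} {l : Fin 3 → ℝ} (hl : ∀ i, 0 < l i)
    (hq : l 0 ^ 2 - l 1 ^ 2 = q) (hr : l 1 ^ 2 - l 2 ^ 2 = r) : axes l ∈ leaf q r := by
  have h0 := hl 0
  have h1 := hl 1
  have h2 := hl 2
  refine ⟨?_, ?_, ?_, ?_⟩
  · rw [Phi_axes, neg_lt_zero]
    positivity
  · intro i j hij
    fin_cases i <;> fin_cases j <;> simp [ip_eq_coord, axes] at hij ⊢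
  · rw [ip_axes_self, ip_axes_self, hq]
  · rw [ip_axes_self, ip_axes_self, hr]

theorem leafCurvature_eq_zero (P : TangentPlane (leaf 0 0)) : leafCurvature 0 0 P = 0 := by
  have hp := P.point_mem
  have e1 : slope 0 P.point = slope 1 P.point := by
    rw [slope, slope, sub_eq_zero.1 hp.2.2.1]
  have e2 : slope 1 P.point = slope 2 P.point := by
    rw [slope, slope, sub_eq_zero.1 hp.2.2.2]
  have h0 : ∀ i, curvCoeff P.point i = 0 := by
    intro i
    fin_cases i <;> simp [curvCoeff, e1, e2] <;> ring
  simp [leafCurvature, sectionalCurv, h0]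

/-- With x = s₀ and y = s₁ = s₂, the coefficients are x(x - y) and twice -x(x - y)/2, while Φ = x y²
and q = y(y - x). The curvature is thus at most |x - y|/y², and the argument in fact gives 1/√q. -/
theorem abs_leafCurvature_le {q : ℝ} (hq : 0 < q) (P : TangentPlane (leaf q 0)) :
    |leafCurvature q 0 P| ≤ 12 / √q := by
  have hp := P.point_mem
  have h := isOrthogonal_of_mem_leaf hp
  have hs : 0 < √q := Real.sqrt_pos.2 hq
  refine abs_sectionalCurv_le (by positivity) fun i => ?_
  have e2 : slope 2 P.point = slope 1 P.point := by
    rw [slope, slope, sub_eq_zero.1 hp.2.2.2]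
  have hq' := hp.2.2.1
  rw [h.ip00, h.ip11, e2] at hq'
  have hP : 0 < slope 1 P.point * slope 0 P.point := by
    have := ip_self_pos (x := P.point 1) (fun h0 => by
      have := ip_self_ne_zero_of_Phi h.Phi_ne 1
      simp [h0, ← ipL_apply] at this)
    rwa [h.ip11, e2] at this
  rw [h.Phi_eq, e2]
  have hcoeff : |curvCoeff P.point i| ≤ |slope 0 P.point * (slope 0 P.point - slope 1 P.point)| := by
    fin_cases i
    · apply le_of_eq
      simp only [curvCoeff, Fin.zero_eta, zero_add, e2]
      congr 1; ring
    · have : curvCoeff P.point 1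
          = -(slope 0 P.point * (slope 0 P.point - slope 1 P.point)) / 2 := by
        simp only [curvCoeff, Fin.reduceAdd, e2]; ring
      simp only [Fin.mk_one, this, abs_div, abs_neg, abs_two]
      exact half_le_self (abs_nonneg _)
    · have : curvCoeff P.point 2
          = -(slope 0 P.point * (slope 0 P.point - slope 1 P.point)) / 2 := by
        simp only [curvCoeff, Fin.reduceAdd, e2]; ring
      simp only [Fin.reduceFinMk, this, abs_div, abs_neg, abs_two]
      exact half_le_self (abs_nonneg _)
  refine hcoeff.trans ?_
  generalize slope 0 P.point = x at *
  generalize slope 1 P.point = y at *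
  rw [abs_mul, abs_mul, abs_mul, div_mul_eq_mul_div, le_div_iff₀ hs]
  have hsq : √q * √q = q := Real.mul_self_sqrt hq.le
  -- Here y² = |a₀|² = q + xy with xy = |a₁|² > 0.
  have h1 : √q ≤ |y| := Real.sqrt_le_left (abs_nonneg _) |>.2 (by rw [sq_abs]; nlinarith)
  have h2 : |x - y| * |y| = q := by
    rw [← abs_mul, ← abs_neg, ← hq', show -((x - y) * y) = y * y - y * x by ring, hq',
      abs_of_pos hq]
  have h3 : |x - y| ≤ |y| := by
    have hy : 0 < |y| := hs.trans_le h1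
    by_contra! hlt
    nlinarith
  have h4 : |x - y| * √q ≤ |y| * |y| := mul_le_mul h3 h1 hs.le (abs_nonneg _)
  have h5 := mul_le_mul_of_nonneg_left h4 (abs_nonneg x)
  have h6 : 0 ≤ |x| * (|y| * |y|) := by positivity
  linarith

theorem slope_axes (l : Fin 3 → ℝ) (i : Fin 3) :
    slope i (axes l) = -(l 0 * l 1 * l 2) / l i ^ 2 := by
  rw [slope, Phi_axes, ip_axes_self]

theorem exists_leafCurvature_eq {q l : ℝ} (hl : 0 < l) (h : q < l ^ 2) :
    ∃ P, leafCurvature q 0 P = q / l ^ 3 := by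
  have hm : 0 < √(l ^ 2 - q) := Real.sqrt_pos.2 (sub_pos.2 h)
  have hsq : √(l ^ 2 - q) ^ 2 = l ^ 2 - q := Real.sq_sqrt (sub_pos.2 h).le
  set m := √(l ^ 2 - q)
  have hmem : axes ![l, m, m] ∈ leaf q 0 := by
    apply axes_mem_leaf
    · intro i; fin_cases i; exacts [hl, hm, hm]
    · simp only [Matrix.cons_val_zero, Matrix.cons_val_one]; linarith
    · simp
  refine ⟨radialPlane hmem 0, ?_⟩
  rw [leafCurvature_radialPlane, curvCoeff, slope_axes, slope_axes, slope_axes, Phi_axes]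
  simp only [Matrix.cons_val_zero, Matrix.cons_val_one, Matrix.cons_val, zero_add]
  rw [show q = l ^ 2 - m ^ 2 by linarith]
  field_simp
  ring

theorem exists_le_abs_leafCurvature {q r t : ℝ} (hq : 0 ≤ q) (hr : 0 < r) (ht : 0 < t) :
    ∃ P, r / (2 * t ^ 3) ≤ |leafCurvature q r P| := by
  have hB : 0 < t ^ 2 + r := by positivity
  have hA : 0 < t ^ 2 + r + q := by positivity
  have hm : 0 < √(t ^ 2 + r) := Real.sqrt_pos.2 hB
  have hl : 0 < √(t ^ 2 + r + q) := Real.sqrt_pos.2 hA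
  have hm2 : √(t ^ 2 + r) ^ 2 = t ^ 2 + r := Real.sq_sqrt hB.le
  have hl2 : √(t ^ 2 + r + q) ^ 2 = t ^ 2 + r + q := Real.sq_sqrt hA.le
  have hml : √(t ^ 2 + r) ≤ √(t ^ 2 + r + q) := Real.sqrt_le_sqrt (by linarith)
  set m := √(t ^ 2 + r)
  set l := √(t ^ 2 + r + q)
  have hmem : axes ![l, m, t] ∈ leaf q r := by
    apply axes_mem_leaf
    · intro i; fin_cases i; exacts [hl, hm, ht]
    · simp only [Matrix.cons_val_zero, Matrix.cons_val_one]; linarith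
    · simp only [Matrix.cons_val_one, Matrix.cons_val]; linarith
  refine ⟨radialPlane hmem 2, ?_⟩
  rw [leafCurvature_radialPlane, abs_div, Phi_axes]
  simp only [Matrix.cons_val_zero, Matrix.cons_val_one, Matrix.cons_val]
  rw [abs_neg, abs_of_pos (show 0 < l * m * t by positivity), le_div_iff₀ (by positivity)]
  refine le_trans ?_ (le_abs_self _)
  -- The dominant term l²m²/t² is split in two: one half, with m² = r + t², supplies the bound, the
  -- other absorbs the negative terms.
  have hw : curvCoeff (axes ![l, m, t]) 2 = r * l ^ 2 / (2 * t ^ 2)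
      + (l ^ 4 * m ^ 4 - m ^ 4 * t ^ 4 - l ^ 4 * t ^ 4 + 2 * l ^ 2 * m ^ 2 * t ^ 4
        - l ^ 2 * m ^ 4 * t ^ 2) / (2 * l ^ 2 * m ^ 2 * t ^ 2) := by
    rw [curvCoeff, slope_axes, slope_axes, slope_axes]
    simp only [Matrix.cons_val_zero, Matrix.cons_val_one, Matrix.cons_val, Fin.reduceAdd]
    rw [show r = m ^ 2 - t ^ 2 by linarith]
    field_simp
    ring
  have hpos : 0 ≤ l ^ 4 * m ^ 4 - m ^ 4 * t ^ 4 - l ^ 4 * t ^ 4 + 2 * l ^ 2 * m ^ 2 * t ^ 4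
        - l ^ 2 * m ^ 4 * t ^ 2 := by
    rw [show l ^ 4 = (l ^ 2) ^ 2 by ring, show m ^ 4 = (m ^ 2) ^ 2 by ring, hl2, hm2]
    ring_nf
    positivity
  rw [hw]
  have h1 : r / (2 * t ^ 3) * (l * m * t) ≤ r * l ^ 2 / (2 * t ^ 2) := by
    rw [div_mul_eq_mul_div, div_le_div_iff₀ (by positivity) (by positivity)]
    have : l * m ≤ l * l := mul_le_mul_of_nonneg_left hml hl.le
    calc r * (l * m * t) * (2 * t ^ 2) = (l * m) * (2 * r * t ^ 3) := by ring
      _ ≤ (l * l) * (2 * r * t ^ 3) := mul_le_mul_of_nonneg_right this (by positivity)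
      _ = r * l ^ 2 * (2 * t ^ 3) := by ring
  have h2 := div_nonneg hpos (show 0 ≤ 2 * l ^ 2 * m ^ 2 * t ^ 2 by positivity)
  linarith

end HyperLiePoisson

end

theorem theorem4p1 (q r : ℝ) (hq : 0 ≤ q) (hr : 0 ≤ r) :
    ∃ κ : SubmanifoldGeometry.TangentPlane (HyperLiePoisson.leaf q r) → ℝ,
      SubmanifoldGeometry.IsSectionalCurvature (HyperLiePoisson.leaf q r)
        HyperLiePoisson.metric κ ∧
      (q = 0 → r = 0 → ∀ P, κ P = 0) ∧
      (0 < q → r = 0 → (¬ ∃ c : ℝ, ∀ P, κ P = c) ∧ ∀ P, |κ P| ≤ 12 / Real.sqrt q) ∧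
      (0 < r → ¬ ∃ C : ℝ, ∀ P, |κ P| ≤ C) := by
  refine ⟨HyperLiePoisson.leafCurvature q r,
    HyperLiePoisson.isSectionalCurvature_leafCurvature q r, ?_, ?_, ?_⟩
  · rintro rfl rfl
    exact HyperLiePoisson.leafCurvature_eq_zero
  · rintro hq0 rfl
    refine ⟨?_, HyperLiePoisson.abs_leafCurvature_le hq0⟩
    rintro ⟨c, hc⟩
    have hs : 0 < √q := Real.sqrt_pos.2 hq0
    have hsq : √q ^ 2 = q := Real.sq_sqrt hq
    -- Any two different lengths above √q would do, since q/l³ is injective in l > 0.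
    obtain ⟨P, hP⟩ := HyperLiePoisson.exists_leafCurvature_eq (q := q) (l := 2 * √q) (by positivity)
      (by rw [mul_pow, hsq]; linarith)
    obtain ⟨P', hP'⟩ := HyperLiePoisson.exists_leafCurvature_eq (q := q) (l := 3 * √q)
      (by positivity) (by rw [mul_pow, hsq]; linarith)
    have h := hP.symm.trans ((hc P).trans ((hc P').symm.trans hP'))
    rw [div_eq_div_iff (by positivity) (by positivity)] at h
    have := mul_left_cancel₀ hq0.ne' h
    nlinarith [pow_pos hs 3]
  · rintro hr0 ⟨C, hC⟩
    -- The minimum with 1 gives t³ ≤ t; the +1 makes 2t³|C| < r strict, contradicting r ≤ 2t³|C|.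
    set t := min 1 (r / (2 * (|C| + 1))) with ht
    have ht0 : 0 < t := lt_min one_pos (by positivity)
    obtain ⟨P, hP⟩ := HyperLiePoisson.exists_le_abs_leafCurvature hq hr0 ht0
    have h1 := hP.trans ((hC P).trans (le_abs_self C))
    rw [div_le_iff₀ (by positivity)] at h1
    have h2 : t * (2 * (|C| + 1)) ≤ r := by
      rw [← le_div_iff₀ (by positivity)]
      exact min_le_right _ _
    have h3 : t ^ 3 ≤ t := by
      have : t ≤ 1 := min_le_left _ _
      calc t ^ 3 ≤ t ^ 1 := pow_le_pow_of_le_one ht0.le this (by norm_num)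
        _ = t := pow_one t
    nlinarith [mul_le_mul_of_nonneg_left h3 (abs_nonneg C)]
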